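/- Let $(\overline M,\overline g)$ be an $(m+n)$-dimensional semi-Riemannian manifold (smooth, Hausdorff, second countable, $\overline g$ of constant index) with Levi-Civita connection $\overline\nabla$ and curvature tensor $\overline R(X,Y)Z=\overline\nabla_X\overline\nabla_YZ-\overline\nabla_Y\overline\nabla_XZ-\overline\nabla_{[X,Y]}Z$, and let $M$ be an $m$-dimensional immersed submanifold of codimension $n$ with induced (possibly degenerate) metric $g$. Put $\operatorname{Rad}T_uM=T_uM\cap (T_uM)^\perp$. Assume that $M$ is coisotropic: $\operatorname{Rad}TM$ is a smooth distribution on $M$ of rank $n>0$. Let $S(TM)$ be a screen distribution, i.e. a smooth distribution with $TM=\operatorname{Rad}TM\oplus S(TM)$, and let $P:TM\to S(TM)$ be the corresponding projection. Let $\operatorname{ltr}(TM)$ be a lightlike transversal bundle, i.e. a subbundle of $T\overline M|_M$ with $T\overline M|_M=TM\oplus \operatorname{ltr}(TM)$ which is locally spanned by smooth sections $N_1,\dots,N_n$ orthogonal to $S(TM)$ with $\overline g(\xi_i,N_j)=\delta_{ij}$ and $\overline g(N_i,N_j)=0$ for some local frame $\xi_1,\dots,\xi_n$ of $\operatorname{Rad}TM$.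 Define the induced connection $\nabla$ on $M$ and the second fundamental forms $h^l$ and $\overset{*}{h}$ by $$\overline\nabla_XY=\nabla_XY+h^l(X,Y),\qquad \nabla_X PY=\overset{*}{\nabla}_XPY+\overset{*}{h}(X,PY),$$ with $\nabla_XY\in TM$, $h^l(X,Y)\in \operatorname{ltr}(TM)$, $\overset{*}{\nabla}_XPY\in S(TM)$, $\overset{*}{h}(X,PY)\in\operatorname{Rad}TM$, and let $R$ be the curvature of $\nabla$, $R(X,Y,Z,W)=g(R(X,Y)Z,W)$. Assume that 1. every point of $M$ has an open neighbourhood $\mathcal U$ with frames $\{\xi_i\}$ of $\operatorname{Rad}TM$ and $\{N_i\}$ of $\operatorname{ltr}(TM)$ as above and smooth functions $\varphi_1,\dots,\varphi_n$ on $\mathcal U$ such that, writing $h^l=\sum_i h^l_iN_i$ and $\overset{*}{h}=\sum_i\overset{*}{h}_i\xi_i$, $$\overset{*}{h}_i(X,PY)=\varphi_i\,h^l_i(X,PY)\qquad\text{for all smooth vector fields } X,Y \text{ on }\mathcal U\text{ tangent to } M\text{ and all } i;$$ 2. the distribution $\operatorname{Rad}TM$ is integrable (through every point of $M$ there passes an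 integral manifold); 3. $\overline R(X,PY)\operatorname{Rad}TM\subset \operatorname{Rad}TM$ for all $X,Y$ tangent to $M$. Then the induced curvature $R$ of $M$ is an algebraic curvature tensor: at every $u\in M$ it defines a $4$-linear form $F$ on $T_uM$ with $$F(x,y,z,w)=-F(y,x,z,w)=F(z,w,x,y),\qquad F(x,y,z,w)+F(y,z,x,w)+F(z,x,y,w)=0 .$$ -/

import Mathlib

open scoped Manifold ContDiff

noncomputable section

namespace CoisotropicGeometry

section Ambient

variable {E : Type*} [NormedAddCommGroup E] [NormedSpace ℝ E] [FiniteDimensional ℝ E]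
  {H : Type*} [TopologicalSpace H] {I : ModelWithCorners ℝ E H}
  {M : Type*} [TopologicalSpace M] [ChartedSpace H M] [IsManifold I ∞ M]

/-- The curvature operator of `D`, where `D X Z` stands for `∇_X Z`:
`R(X, Y) Z = ∇_X ∇_Y Z - ∇_Y ∇_X Z - ∇_{[X, Y]} Z`. -/
def curvature
    (D : (Π x : M, TangentSpace I x) → (Π x : M, TangentSpace I x) → Π x : M, TangentSpace I x)
    (X Y Z : Π x : M, TangentSpace I x) : Π x : M, TangentSpace I x :=
  D X (D Y Z) - D Y (D X Z) - D (VectorField.mlieBracket I X Y) Z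

/-- The curvature tensor `R_x(u, v) w` of a covariant derivative on the tangent bundle, evaluated
on tangent vectors through the local extensions of `u`, `v`, `w` that are constant in the
trivialization at `x`; the curvature of a smooth connection is a tensor, so that every other choice
of smooth extensions gives the same value. -/
def curvatureAt (nabla : CovariantDerivative I E (TangentSpace I : M → Type _)) (x : M)
    (u v w : TangentSpace I x) : TangentSpace I x :=
  curvature (fun X Z y ↦ nabla Z y (X y))
    (FiberBundle.extend E u) (FiberBundle.extend E v) (FiberBundle.extend E w) x

variable (I M) in
/-- A semi-Riemannian metric: a smooth field of nondegenerate symmetric bilinear forms of constant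
index on the tangent spaces. -/
structure SemiRiemannianMetric where
  val : ∀ x : M, TangentSpace I x →L[ℝ] TangentSpace I x →L[ℝ] ℝ
  symm : ∀ (x : M) (v w : TangentSpace I x), val x v w = val x w v
  nondegenerate : ∀ (x : M) (v : TangentSpace I x), (∀ w, val x v w = 0) → v = 0
  contMDiff : ContMDiff I (I.prod 𝓘(ℝ, E →L[ℝ] E →L[ℝ] ℝ)) ∞
    (fun x ↦ Bundle.TotalSpace.mk' (E →L[ℝ] E →L[ℝ] ℝ) x (val x))
  constant_index : ∃ ν : ℕ, ∀ x : M, sigNeg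
    (LinearMap.BilinMap.toQuadraticMap (val x).toBilinForm) = ν

/-- `nabla` is the Levi-Civita connection of `g`: the smooth linear connection on the tangent bundle
that is torsion free and satisfies `v g(Y, Z) = g(∇_v Y, Z) + g(Y, ∇_v Z)`. -/
structure SemiRiemannianMetric.IsLeviCivita (g : SemiRiemannianMetric I M)
    (nabla : CovariantDerivative I E (TangentSpace I : M → Type _)) : Prop where
  smooth : CovariantDerivative.ContMDiffCovariantDerivative nabla ∞
  torsion_free : nabla.torsion = 0
  metric : ∀ (x : M) (v : TangentSpace I x) (Y Z : Π x : M, TangentSpace I x),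
    MDifferentiableAt I I.tangent (fun y ↦ (⟨y, Y y⟩ : TangentBundle I M)) x →
    MDifferentiableAt I I.tangent (fun y ↦ (⟨y, Z y⟩ : TangentBundle I M)) x →
    mvfderiv I (fun y ↦ g.val y (Y y) (Z y)) x v =
      g.val x (nabla Y x v) (Z x) + g.val x (Y x) (nabla Z x v)

/-- The vector field `X` is smooth on the set `U`. -/
def SmoothFieldOn (X : Π x : M, TangentSpace I x) (U : Set M) : Prop :=
  ContMDiffOn I I.tangent ∞ (fun x ↦ (⟨x, X x⟩ : TangentBundle I M)) U

/-- The smooth vector fields `X 1, …, X k` on `U` form a frame of the distribution `D` over `U`. -/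
structure IsDistributionFrameOn {k : ℕ} (D : ∀ x : M, Submodule ℝ (TangentSpace I x))
    (X : Fin k → Π x : M, TangentSpace I x) (U : Set M) : Prop where
  smooth : ∀ i, SmoothFieldOn (X i) U
  linearIndependent : ∀ x ∈ U, LinearIndependent ℝ (fun i ↦ X i x)
  span_eq : ∀ x ∈ U, Submodule.span ℝ (Set.range fun i ↦ X i x) = D x

/-- `D` is a smooth distribution of rank `k`. -/
def IsSmoothDistribution (k : ℕ) (D : ∀ x : M, Submodule ℝ (TangentSpace I x)) : Prop :=
  ∀ x : M, ∃ U : Set M, IsOpen U ∧ x ∈ U ∧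
    ∃ X : Fin k → Π y : M, TangentSpace I y, IsDistributionFrameOn D X U

/-- The distribution `D` of rank `k` is integrable: through every point of `M` there passes an
integral manifold of `D`, here given by a local parametrization `j` on an open set `U` of `ℝ^k`. -/
def IsIntegrableDistribution (k : ℕ) (D : ∀ x : M, Submodule ℝ (TangentSpace I x)) : Prop :=
  ∀ x : M, ∃ (U : Set (EuclideanSpace ℝ (Fin k))) (j : EuclideanSpace ℝ (Fin k) → M),
    IsOpen U ∧ (∃ t ∈ U, j t = x) ∧ ContMDiffOn (𝓡 k) I ∞ j U ∧
    ∀ t ∈ U, Function.Injective (mfderiv (𝓡 k) I j t) ∧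
      LinearMap.range (mfderiv (𝓡 k) I j t).toLinearMap = D (j t)

end Ambient

/-- An algebraic curvature tensor on a real vector space. -/
structure IsAlgebraicCurvatureTensor {V : Type*} [AddCommGroup V] [Module ℝ V]
    (F : V →ₗ[ℝ] V →ₗ[ℝ] V →ₗ[ℝ] V →ₗ[ℝ] ℝ) : Prop where
  antisymm : ∀ x y z w, F x y z w = -F y x z w
  pair_symm : ∀ x y z w, F x y z w = F z w x y
  bianchi : ∀ x y z w, F x y z w + F y z x w + F z x y w = 0

/-- The differential of an immersion is injective at every point. -/
theorem injective_mfderiv_of_isImmersion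
    {E : Type*} [NormedAddCommGroup E] [NormedSpace ℝ E]
    {H : Type*} [TopologicalSpace H] {I : ModelWithCorners ℝ E H}
    {M : Type*} [TopologicalSpace M] [ChartedSpace H M] [IsManifold I ∞ M]
    {E' : Type*} [NormedAddCommGroup E'] [NormedSpace ℝ E']
    {H' : Type*} [TopologicalSpace H'] {I' : ModelWithCorners ℝ E' H'}
    {N : Type*} [TopologicalSpace N] [ChartedSpace H' N] [IsManifold I' ∞ N]
    {f : M → N} (hf : Manifold.IsImmersion I I' ∞ f) (x : M) :
    Function.Injective (mfderiv I I' f x) := by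
  have h := hf.isImmersionAt x
  set φ := h.domChart
  set ψ := h.codChart
  have hx : x ∈ φ.source := h.mem_domChart_source
  have hfx : f x ∈ ψ.source := h.mem_codChart_source
  have hφ1 : φ ∈ IsManifold.maximalAtlas I 1 M :=
    IsManifold.maximalAtlas_subset_of_le (by simp) h.domChart_mem_maximalAtlas
  have hψ1 : ψ ∈ IsManifold.maximalAtlas I' 1 N :=
    IsManifold.maximalAtlas_subset_of_le (by simp) h.codChart_mem_maximalAtlas
  have hφ : MDifferentiableAt I 𝓘(ℝ, E) (φ.extend I) x :=
    I.mdifferentiableAt.comp x (mdifferentiableAt_of_mem_maximalAtlas hφ1 hx)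
  have hψ : MDifferentiableAt I' 𝓘(ℝ, E') (ψ.extend I') (f x) :=
    I'.mdifferentiableAt.comp (f x) (mdifferentiableAt_of_mem_maximalAtlas hψ1 hfx)
  have hfd : MDifferentiableAt I I' f x := (hf.contMDiff x).mdifferentiableAt (by simp)
  let A : E' →L[ℝ] E := (ContinuousLinearMap.fst ℝ E h.complement).comp
    (h.equiv.symm : E' →L[ℝ] E × h.complement)
  have hA : MDifferentiableAt 𝓘(ℝ, E') 𝓘(ℝ, E) A (ψ.extend I' (f x)) :=
    A.differentiableAt.mdifferentiableAt
  have key : (A ∘ ψ.extend I') ∘ f =ᶠ[nhds x] φ.extend I := by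
    filter_upwards [φ.open_source.mem_nhds hx] with y hy
    have hy' : y ∈ (φ.extend I).source := by simpa using hy
    have := h.writtenInCharts ((φ.extend I).map_source hy')
    simp only [Function.comp_apply] at this ⊢
    rw [(φ.extend I).left_inv hy'] at this
    rw [this]
    simp [A]
  have hcomp : mfderiv I 𝓘(ℝ, E) (φ.extend I) x =
      (mfderiv I' 𝓘(ℝ, E) (A ∘ ψ.extend I') (f x)).comp (mfderiv I I' f x) := by
    rw [← key.mfderiv_eq]
    exact mfderiv_comp x (hA.comp _ hψ) hfd
  have hinj : Function.Injective (mfderiv I 𝓘(ℝ, E) (φ.extend I) x) := by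
    have hm : φ.MDifferentiable I I := by
      refine ⟨fun y hy => ?_, fun y hy => ?_⟩
      · exact (mdifferentiableAt_of_mem_maximalAtlas hφ1 hy).mdifferentiableWithinAt
      · exact (mdifferentiableAt_symm_of_mem_maximalAtlas hφ1 hy).mdifferentiableWithinAt
    have : mfderiv I 𝓘(ℝ, E) (φ.extend I) x =
      (mfderiv I 𝓘(ℝ, E) I (φ x)).comp (mfderiv I I φ x) := 
      mfderiv_comp x I.mdifferentiableAt (hm.mdifferentiableAt hx)
    rw [this, I.hasMFDerivAt.mfderiv]
    exact hm.mfderiv_injective hx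
  rw [hcomp] at hinj
  exact Function.Injective.of_comp (f := mfderiv I' 𝓘(ℝ, E) (A ∘ ψ.extend I') (f x)) hinj

section Submanifold

variable {E : Type*} [NormedAddCommGroup E] [NormedSpace ℝ E] [FiniteDimensional ℝ E]
  {H : Type*} [TopologicalSpace H] {I : ModelWithCorners ℝ E H}
  {M : Type*} [TopologicalSpace M] [ChartedSpace H M] [IsManifold I ∞ M]
  {E' : Type*} [NormedAddCommGroup E'] [NormedSpace ℝ E'] [FiniteDimensional ℝ E']
  {H' : Type*} [TopologicalSpace H'] {I' : ModelWithCorners ℝ E' H'}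
  {N : Type*} [TopologicalSpace N] [ChartedSpace H' N] [IsManifold I' ∞ N]

/-- The covariant derivative `∇_x V` of a vector field `V` along `f : M → N` in the direction
`x ∈ T_p M`, i.e. the pullback connection. In the trivialization of `TN` at `f p`, with constant
frame `∂_k`, one has `V = ∑ V^k ∂_k ∘ f` and `∇_x V = ∑ (x V^k) ∂_k + ∑ V^k(p) ∇_{df x} ∂_k`; the
second sum is the derivative of the extension of `V p` with constant coefficients. -/
def covDerivAlong (nabla : CovariantDerivative I' E' (TangentSpace I' : N → Type _)) (f : M → N)
    (V : Π q : M, TangentSpace I' (f q)) (p : M) (x : TangentSpace I p) : TangentSpace I' (f p) :=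
  (trivializationAt E' (TangentSpace I' : N → Type _) (f p)).symm (f p)
      (mvfderiv I (fun q ↦
        (trivializationAt E' (TangentSpace I' : N → Type _) (f p)
          (⟨f q, V q⟩ : TangentBundle I' N)).2) p x)
    + nabla (FiberBundle.extend E' (V p)) (f p) (mfderiv I I' f p x)

/-- The metric induced on `M` by `f : M → N`; it may be degenerate. -/
def inducedMetric (g : SemiRiemannianMetric I' N) (f : M → N) (p : M) :
    LinearMap.BilinForm ℝ (TangentSpace I p) :=
  (g.val (f p)).toBilinForm.compl₁₂ (mfderiv I I' f p).toLinearMap (mfderiv I I' f p).toLinearMap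

/-- The radical `Rad T_p M = T_p M ∩ (T_p M)^⊥`. -/
def radical (g : SemiRiemannianMetric I' N) (f : M → N) (p : M) :
    Submodule ℝ (TangentSpace I p) :=
  LinearMap.ker (inducedMetric g f p)

variable (I) in
/-- The submanifold `f : M → N` is coisotropic of codimension `r`: it is lightlike, i.e. its radical
is a smooth distribution of positive rank, and this rank equals the codimension `r`. -/
def IsCoisotropic (g : SemiRiemannianMetric I' N) (f : M → N) (r : ℕ) : Prop :=
  Module.finrank ℝ E' = Module.finrank ℝ E + r ∧ 0 < r ∧
    IsSmoothDistribution r (radical (I := I) g f)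

variable (I) in
/-- A screen distribution `S(TM)`: a smooth distribution complementary to the radical in `TM`.
It is automatically orthogonal to the radical, and the metric is nondegenerate on it. -/
structure ScreenDistribution (g : SemiRiemannianMetric I' N) (f : M → N) where
  fiber : ∀ p : M, Submodule ℝ (TangentSpace I p)
  isCompl : ∀ p, IsCompl (fiber p) (radical g f p)
  smooth : ∃ k : ℕ, IsSmoothDistribution k fiber

/-- The projection `P` of `TM` onto the screen distribution along the radical. -/
def ScreenDistribution.proj {g : SemiRiemannianMetric I' N} {f : M → N}
    (S : ScreenDistribution I g f) (p : M) : TangentSpace I p →ₗ[ℝ] TangentSpace I p :=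
  (S.fiber p).projection (radical g f p) (S.isCompl p)

/-- A pair of local frames over `U`: `ξ 1, …, ξ r` of the radical, and `ν 1, …, ν r` of a family
`L` of subspaces of the ambient tangent spaces, such that the `ν i` are smooth and orthogonal to the
screen distribution, `g(ξ i, ν j) = δ_ij` and `g(ν i, ν j) = 0`. -/
structure IsNullFramePairOn {g : SemiRiemannianMetric I' N} {f : M → N}
    (S : ScreenDistribution I g f) (L : ∀ p : M, Submodule ℝ (TangentSpace I' (f p))) {r : ℕ}
    (ξ : Fin r → Π p : M, TangentSpace I p) (ν : Fin r → Π p : M, TangentSpace I' (f p))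
    (U : Set M) : Prop where
  frame : IsDistributionFrameOn (radical g f) ξ U
  smooth : ∀ i, ContMDiffOn I I'.tangent ∞ (fun p ↦ (⟨f p, ν i p⟩ : TangentBundle I' N)) U
  span_eq : ∀ p ∈ U, Submodule.span ℝ (Set.range fun i ↦ ν i p) = L p
  orthogonal_screen : ∀ p ∈ U, ∀ i, ∀ x ∈ S.fiber p, g.val (f p) (mfderiv I I' f p x) (ν i p) = 0
  dual : ∀ p ∈ U, ∀ i j, g.val (f p) (mfderiv I I' f p (ξ i p)) (ν j p) = if i = j then 1 else 0
  null : ∀ p ∈ U, ∀ i j, g.val (f p) (ν i p) (ν j p) = 0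

/-- A lightlike transversal bundle `ltr(TM)` of a coisotropic submanifold with screen distribution
`S`: it is complementary to `TM` in the ambient tangent bundle along `M`, and it is locally spanned
by a frame `ν i` as in `IsNullFramePairOn`. -/
structure LightlikeTransversalBundle {g : SemiRiemannianMetric I' N} {f : M → N}
    (S : ScreenDistribution I g f) (r : ℕ) where
  fiber : ∀ p : M, Submodule ℝ (TangentSpace I' (f p))
  isCompl : ∀ p, IsCompl (LinearMap.range (mfderiv I I' f p).toLinearMap) (fiber p)
  exists_frame : ∀ p : M, ∃ U : Set M, IsOpen U ∧ p ∈ U ∧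
    ∃ (ξ : Fin r → Π q : M, TangentSpace I q) (ν : Fin r → Π q : M, TangentSpace I' (f q)),
      IsNullFramePairOn S fiber ξ ν U

variable {g : SemiRiemannianMetric I' N} {f : M → N} {S : ScreenDistribution I g f} {r : ℕ}

/-- The component in `T_p M` of an ambient tangent vector at `f p`, with respect to
`T_{f p} N = T_p M ⊕ ltr(TM)_p`. -/
def tangentialPart (hf : Manifold.IsImmersion I I' ∞ f) (L : LightlikeTransversalBundle S r)
    (p : M) : TangentSpace I' (f p) →ₗ[ℝ] TangentSpace I p :=
  LinearMap.linearProjOfIsCompl (L.fiber p) (mfderiv I I' f p).toLinearMap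
    (injective_mfderiv_of_isImmersion hf p) (L.isCompl p)

/-- The induced connection `∇_X Y` on `M`: the tangential part of the ambient derivative. -/
def inducedConnection (nabla : CovariantDerivative I' E' (TangentSpace I' : N → Type _))
    (hf : Manifold.IsImmersion I I' ∞ f) (L : LightlikeTransversalBundle S r)
    (X Y : Π p : M, TangentSpace I p) : Π p : M, TangentSpace I p :=
  fun p ↦ tangentialPart hf L p
    (covDerivAlong nabla f (fun q ↦ mfderiv I I' f q (Y q)) p (X p))

/-- The lightlike second fundamental form `h^l(X, Y)`: the component in `ltr(TM)` of the ambient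
derivative of `Y` along `X`, according to the Gauss formula. -/
def lightlikeSecondForm (nabla : CovariantDerivative I' E' (TangentSpace I' : N → Type _))
    (hf : Manifold.IsImmersion I I' ∞ f) (L : LightlikeTransversalBundle S r)
    (X Y : Π p : M, TangentSpace I p) : Π p : M, TangentSpace I' (f p) :=
  fun p ↦ covDerivAlong nabla f (fun q ↦ mfderiv I I' f q (Y q)) p (X p) -
    mfderiv I I' f p (inducedConnection nabla hf L X Y p)

/-- The screen second fundamental form `h^*(X, PY)`: the component of `∇_X PY` in the radical. -/
def screenSecondForm (nabla : CovariantDerivative I' E' (TangentSpace I' : N → Type _))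
    (hf : Manifold.IsImmersion I I' ∞ f) (L : LightlikeTransversalBundle S r)
    (X Y : Π p : M, TangentSpace I p) : Π p : M, TangentSpace I p :=
  fun p ↦ inducedConnection nabla hf L X (fun q ↦ S.proj q (Y q)) p -
    S.proj p (inducedConnection nabla hf L X (fun q ↦ S.proj q (Y q)) p)

/-- The local screen second fundamental forms are conformal to the local lightlike ones: around
every point there are frames `ξ i` of the radical and `ν i` of `ltr(TM)` as above, and smooth
functions `φ i`, with `h^*_i(X, PY) = φ i h^l_i(X, PY)` for all `i` and all smooth `X`, `Y`. Here
`h^l(X, PY) = ∑ h^l_i(X, PY) ν i` and `h^*(X, PY) = ∑ h^*_i(X, PY) ξ i`, hence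
`h^l_i(X, PY) = g(h^l(X, PY), ξ i)` and `h^*_i(X, PY) = g(h^*(X, PY), ν i)`. -/
def IsScreenConformal (nabla : CovariantDerivative I' E' (TangentSpace I' : N → Type _))
    (hf : Manifold.IsImmersion I I' ∞ f) (L : LightlikeTransversalBundle S r) : Prop :=
  ∀ p : M, ∃ U : Set M, IsOpen U ∧ p ∈ U ∧
    ∃ (ξ : Fin r → Π q : M, TangentSpace I q) (ν : Fin r → Π q : M, TangentSpace I' (f q))
      (φ : Fin r → M → ℝ),
      IsNullFramePairOn S L.fiber ξ ν U ∧ (∀ i, ContMDiffOn I 𝓘(ℝ, ℝ) ∞ (φ i) U) ∧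
      ∀ X Y : Π q : M, TangentSpace I q, SmoothFieldOn X U → SmoothFieldOn Y U →
        ∀ q ∈ U, ∀ i,
          g.val (f q) (mfderiv I I' f q (screenSecondForm nabla hf L X Y q)) (ν i q) =
            φ i q * g.val (f q)
              (lightlikeSecondForm nabla hf L X (fun q' ↦ S.proj q' (Y q')) q)
              (mfderiv I I' f q (ξ i q))

end Submanifold

end CoisotropicGeometry

end

open CoisotropicGeometry

/-! The proof is a Gauss equation in which every correction term becomes a Kulkarni-Nomizu product.
Put $B_i(x,y)=\overline g(h^l(x,y),\xi_i)$, a symmetric bilinear form (`hessianForm`). The radical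
is invisible to $g$, and the screen is orthogonal to $\operatorname{ltr}(TM)$, so $g(R(X,Y)Z,W)$ is
the $\overline g$-product with $PW$ of an ambient derivative expression. Commuting the derivatives
gives $$g(R(X,Y)Z,W)=\overline g(\overline R(X,Y)Z,PW)+\sum_i\bigl(B_i(X,Z)\,\overline
g(\overline\nabla_YN_i,PW)-B_i(Y,Z)\,\overline g(\overline\nabla_XN_i,PW)\bigr).$$ Since $N_i\perp
S(TM)$, one has $\overline g(\overline\nabla_XN_i,PW)=-\overline
g(N_i,\overline\nabla_XPW)=-\overset{*}{h}_i(X,PW)=-\varphi_iB_i(X,PW)$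
(`metric_covDerivAlong_transversal`).

The form $B_i(X,PW)$ may be replaced by $B_i(X,W)$ because $B_i$ vanishes on the radical
(`hessianForm_radical`). Metric compatibility gives $B_i(x,\xi_j)=-B_j(x,\xi_i)$, and integrability
of the radical gives $B_i(\xi_j,x)=B_j(\xi_i,x)$; with the symmetry of the forms both sides are
zero. The sum is therefore $\sum_i\varphi_i\bigl(B_i(Y,Z)B_i(X,W)-B_i(X,Z)B_i(Y,W)\bigr)$
(`inducedMetric_curvature`), which has all curvature symmetries.

It remains to treat $\overline g(\overline R(x,y)z,Pw)$. Antisymmetry and the Bianchi identity are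
inherited from $\overline R$. For pair symmetry, the holonomy condition lets each of $x,y,z$ be
replaced by its screen part (`exists_isAlgebraicCurvatureTensor`), and then the pair symmetry of
$\overline R$ applies.

The calculus of fields along $f$ is carried out in charts, with Christoffel symbols (`alongDeriv`),
and transported to the manifolds by `coord_covDerivAlong`. Integrability enters through a
parametrized leaf (`metric_localHessian_leaf_symm`), not through brackets. -/

set_option linter.unusedSectionVars false

namespace CoisotropicGeometry

/-! ### Connections and fields along a map, in coordinates. -/

section LocalCalculus

open Filter Topology

variable {E E' E'' E₃ : Type*} [NormedAddCommGroup E] [NormedSpace ℝ E]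
  [NormedAddCommGroup E'] [NormedSpace ℝ E'] [NormedAddCommGroup E''] [NormedSpace ℝ E'']
  [NormedAddCommGroup E₃] [NormedSpace ℝ E₃]

/-- The covariant derivative of a vector field `V` along `F : E → E'` for the linear connection with
Christoffel symbols `Γ`, where `Γ y w v` is the derivative of the constant field `w` along `v`. -/
noncomputable def alongDeriv (Γ : E' → E' →L[ℝ] E' →L[ℝ] E') (F V : E → E') (t x : E) : E' :=
  fderiv ℝ V t x + Γ (F t) (V t) (fderiv ℝ F t x)

/-- The curvature `R_y(c, b) a` of the linear connection with Christoffel symbols `Γ`. -/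
noncomputable def localCurvature (Γ : E' → E' →L[ℝ] E' →L[ℝ] E') (y c b a : E') : E' :=
  fderiv ℝ Γ y c a b - fderiv ℝ Γ y b a c + Γ y (Γ y a b) c - Γ y (Γ y a c) b

/-- The second derivative of `F`, corrected by the Christoffel symbols of the target. -/
noncomputable def localHessian (Γ : E' → E' →L[ℝ] E' →L[ℝ] E') (F : E → E') (t x y : E) : E' :=
  -- No Christoffel symbols of the source enter, so the value depends on the source chart, but only
  -- by vectors tangent to `F`; pairing with the radical removes these.
  fderiv ℝ (fderiv ℝ F) t x y + Γ (F t) (fderiv ℝ F t y) (fderiv ℝ F t x)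

/-- `Γ` are the Christoffel symbols of the Levi-Civita connection of `G` near `y₀`. -/
structure IsLocalLeviCivita (G : E' → E' →L[ℝ] E' →L[ℝ] ℝ) (Γ : E' → E' →L[ℝ] E' →L[ℝ] E')
    (y₀ : E') : Prop where
  smooth_metric : ContDiffAt ℝ ∞ G y₀
  smooth_symbols : ContDiffAt ℝ ∞ Γ y₀
  metric_symm : ∀ y v w, G y v w = G y w v
  -- This identity and the next are needed near `y₀`, not only at it: the curvature symmetries come
  -- from differentiating them.
  torsion_free : ∀ᶠ y in 𝓝 y₀, ∀ v w, Γ y v w = Γ y w v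
  compatible : ∀ᶠ y in 𝓝 y₀, ∀ v a b,
    fderiv ℝ G y v a b = G y (Γ y a v) b + G y a (Γ y b v)

lemma contDiffAt_fderiv {F : E → E'} {t : E} (hF : ContDiffAt ℝ ∞ F t) :
    ContDiffAt ℝ ∞ (fderiv ℝ F) t :=
  hF.fderiv_right (by simp)

lemma eventually_differentiableAt {F : E → E'} {t : E} (hF : ContDiffAt ℝ ∞ F t) :
    ∀ᶠ s in 𝓝 t, DifferentiableAt ℝ F s := by
  have h1 : ContDiffAt ℝ 1 F t := hF.of_le (by simp)
  filter_upwards [h1.eventually (by simp)] with s hs using hs.differentiableAt (by simp)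

lemma fderiv_fderiv_symm {F : E → E'} {t : E} (hF : ContDiffAt ℝ ∞ F t) (x y : E) :
    fderiv ℝ (fderiv ℝ F) t x y = fderiv ℝ (fderiv ℝ F) t y x :=
  (hF.isSymmSndFDerivAt (by
    rw [minSmoothness_of_isRCLikeNormedField]
    exact WithTop.coe_le_coe.2 (le_top : (2 : ℕ∞) ≤ ⊤))) x y

lemma fderiv_clm_apply₂ {A : E → E' →L[ℝ] E'' →L[ℝ] E₃} {V : E → E'} {W : E → E''} {t : E}
    (hA : DifferentiableAt ℝ A t) (hV : DifferentiableAt ℝ V t) (hW : DifferentiableAt ℝ W t)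
    (x : E) :
    fderiv ℝ (fun s ↦ A s (V s) (W s)) t x =
      fderiv ℝ A t x (V t) (W t) + A t (fderiv ℝ V t x) (W t) + A t (V t) (fderiv ℝ W t x) := by
  rw [fderiv_clm_apply (hA.clm_apply hV) hW, fderiv_clm_apply hA hV]
  simp
  abel

lemma alongDeriv_smul_fun {Γ : E' → E' →L[ℝ] E' →L[ℝ] E'} {F V : E → E'} {a : E → ℝ} {t : E}
    (ha : DifferentiableAt ℝ a t) (hV : DifferentiableAt ℝ V t) (x : E) :
    alongDeriv Γ F (fun s ↦ a s • V s) t x =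
      fderiv ℝ a t x • V t + a t • alongDeriv Γ F V t x := by
  simp only [alongDeriv]
  rw [fderiv_fun_smul ha hV]
  simp
  module

lemma alongDeriv_sub_sum {ι : Type*} [Fintype ι] {Γ : E' → E' →L[ℝ] E' →L[ℝ] E'} {F V : E → E'}
    {W : ι → E → E'} {t : E} (hV : DifferentiableAt ℝ V t)
    (hW : ∀ i, DifferentiableAt ℝ (W i) t) (x : E) :
    alongDeriv Γ F (fun s ↦ V s - ∑ i, W i s) t x =
      alongDeriv Γ F V t x - ∑ i, alongDeriv Γ F (W i) t x := by
  have h : DifferentiableAt ℝ (fun s ↦ ∑ i, W i s) t :=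
    DifferentiableAt.fun_sum fun i _ ↦ hW i
  simp only [alongDeriv]
  rw [fderiv_fun_sub hV h, fderiv_fun_sum fun i _ ↦ hW i]
  simp [Finset.sum_add_distrib]
  abel

lemma alongDeriv_congr {Γ : E' → E' →L[ℝ] E' →L[ℝ] E'} {F V W : E → E'} {t : E}
    (h : V =ᶠ[𝓝 t] W) (x : E) : alongDeriv Γ F V t x = alongDeriv Γ F W t x := by
  simp only [alongDeriv, h.fderiv_eq, h.eq_of_nhds]

/-- The derivative of a vector field tangent to `F` in terms of the Hessian of `F`. -/
lemma alongDeriv_fderiv_apply {Γ : E' → E' →L[ℝ] E' →L[ℝ] E'} {F : E → E'} {Y : E → E} {t : E}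
    (hF : ContDiffAt ℝ ∞ F t) (hY : DifferentiableAt ℝ Y t) (x : E) :
    alongDeriv Γ F (fun s ↦ fderiv ℝ F s (Y s)) t x =
      localHessian Γ F t x (Y t) + fderiv ℝ F t (fderiv ℝ Y t x) := by
  have h : DifferentiableAt ℝ (fderiv ℝ F) t := (contDiffAt_fderiv hF).differentiableAt (by simp)
  simp only [alongDeriv, localHessian]
  rw [fderiv_clm_apply h hY]
  simp
  abel

lemma ContDiffAt.alongDeriv {Γ : E' → E' →L[ℝ] E' →L[ℝ] E'} {F V : E → E'} {Y : E → E} {t : E}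
    (hΓ : ContDiffAt ℝ ∞ Γ (F t)) (hF : ContDiffAt ℝ ∞ F t) (hV : ContDiffAt ℝ ∞ V t)
    (hY : ContDiffAt ℝ ∞ Y t) :
    ContDiffAt ℝ ∞ (fun s ↦ CoisotropicGeometry.alongDeriv Γ F V s (Y s)) t :=
  ((contDiffAt_fderiv hV).clm_apply hY).add
    (((hΓ.comp t hF).clm_apply hV).clm_apply ((contDiffAt_fderiv hF).clm_apply hY))

/-- The commutator of covariant derivatives along `F` is given by the curvature of the target. -/
lemma alongDeriv_commutator {Γ : E' → E' →L[ℝ] E' →L[ℝ] E'} {F V : E → E'} {X Y : E → E} {t : E}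
    (hΓ : ContDiffAt ℝ ∞ Γ (F t)) (hF : ContDiffAt ℝ ∞ F t) (hV : ContDiffAt ℝ ∞ V t)
    (hX : DifferentiableAt ℝ X t) (hY : DifferentiableAt ℝ Y t) :
    alongDeriv Γ F (fun s ↦ alongDeriv Γ F V s (Y s)) t (X t) -
      alongDeriv Γ F (fun s ↦ alongDeriv Γ F V s (X s)) t (Y t) -
      alongDeriv Γ F V t (fderiv ℝ Y t (X t) - fderiv ℝ X t (Y t)) =
    localCurvature Γ (F t) (fderiv ℝ F t (X t)) (fderiv ℝ F t (Y t)) (V t) := by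
  have hF' : DifferentiableAt ℝ F t := hF.differentiableAt (by simp)
  have hV' : DifferentiableAt ℝ V t := hV.differentiableAt (by simp)
  have hdF : DifferentiableAt ℝ (fderiv ℝ F) t := (contDiffAt_fderiv hF).differentiableAt (by simp)
  have hdV : DifferentiableAt ℝ (fderiv ℝ V) t := (contDiffAt_fderiv hV).differentiableAt (by simp)
  have hΓ' : DifferentiableAt ℝ Γ (F t) := hΓ.differentiableAt (by simp)
  have hΓF : DifferentiableAt ℝ (fun s ↦ Γ (F s)) t :=
    DifferentiableAt.comp (g := Γ) t hΓ' hF'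
  -- One expansion serves both iterated derivatives. In their difference the second derivatives of
  -- `V` and `F` cancel by symmetry, and the terms with the derivative of `Z` form the bracket.
  have key : ∀ (Z : E → E), DifferentiableAt ℝ Z t → ∀ x,
      alongDeriv Γ F (fun s ↦ alongDeriv Γ F V s (Z s)) t x =
      fderiv ℝ (fderiv ℝ V) t x (Z t) + fderiv ℝ V t (fderiv ℝ Z t x) +
      (fderiv ℝ Γ (F t) (fderiv ℝ F t x) (V t) (fderiv ℝ F t (Z t)) +
        Γ (F t) (fderiv ℝ V t x) (fderiv ℝ F t (Z t)) +
        Γ (F t) (V t) (fderiv ℝ (fderiv ℝ F) t x (Z t) + fderiv ℝ F t (fderiv ℝ Z t x))) +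
      Γ (F t) (fderiv ℝ V t (Z t) + Γ (F t) (V t) (fderiv ℝ F t (Z t))) (fderiv ℝ F t x) := by
    intro Z hZ x
    have h1 : fderiv ℝ (fun s ↦ Γ (F s)) t x = fderiv ℝ Γ (F t) (fderiv ℝ F t x) := by
      rw [show (fun s ↦ Γ (F s)) = Γ ∘ F from rfl, fderiv_comp (g := Γ) t hΓ' hF']
      rfl
    have h2 : DifferentiableAt ℝ (fun s ↦ fderiv ℝ F s (Z s)) t := hdF.clm_apply hZ
    rw [alongDeriv]
    simp only [alongDeriv]
    rw [fderiv_fun_add (hdV.clm_apply hZ) ((hΓF.clm_apply hV').clm_apply h2),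
      add_apply, fderiv_clm_apply₂ hΓF hV' h2, h1, fderiv_clm_apply hdV hZ,
      fderiv_clm_apply hdF hZ]
    simp
    abel
  rw [key Y hY, key X hX, fderiv_fderiv_symm hV (X t) (Y t), fderiv_fderiv_symm hF (X t) (Y t)]
  simp only [alongDeriv, localCurvature, map_add, map_sub, add_apply]
  abel

/-- Second derivatives commute, and the Christoffel term is symmetric because the target connection
is torsion free. -/
lemma localHessian_symm {G : E' → E' →L[ℝ] E' →L[ℝ] ℝ} {Γ : E' → E' →L[ℝ] E' →L[ℝ] E'}
    {F : E → E'} {t : E} (h : IsLocalLeviCivita G Γ (F t)) (hF : ContDiffAt ℝ ∞ F t) (x y : E) :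
    localHessian Γ F t x y = localHessian Γ F t y x := by
  rw [localHessian, localHessian, fderiv_fderiv_symm hF, h.torsion_free.self_of_nhds]

lemma fderiv_metric_along {G : E' → E' →L[ℝ] E' →L[ℝ] ℝ} {Γ : E' → E' →L[ℝ] E' →L[ℝ] E'}
    {F V W : E → E'} {t : E} (h : IsLocalLeviCivita G Γ (F t)) (hF : DifferentiableAt ℝ F t)
    (hV : DifferentiableAt ℝ V t) (hW : DifferentiableAt ℝ W t) (x : E) :
    fderiv ℝ (fun s ↦ G (F s) (V s) (W s)) t x =
      G (F t) (alongDeriv Γ F V t x) (W t) + G (F t) (V t) (alongDeriv Γ F W t x) := by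
  have hG : DifferentiableAt ℝ G (F t) := h.smooth_metric.differentiableAt (by simp)
  have hGF : DifferentiableAt ℝ (fun s ↦ G (F s)) t :=
    DifferentiableAt.comp (g := G) t hG hF
  have h1 : fderiv ℝ (fun s ↦ G (F s)) t x = fderiv ℝ G (F t) (fderiv ℝ F t x) := by
    rw [show (fun s ↦ G (F s)) = G ∘ F from rfl, fderiv_comp (g := G) t hG hF]
    rfl
  rw [fderiv_clm_apply₂ hGF hV hW, h1, h.compatible.self_of_nhds]
  simp only [alongDeriv, map_add, add_apply]
  ring

/-- Two orthogonal fields along `F` have opposite mixed derivatives. -/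
lemma metric_alongDeriv_of_orthogonal {G : E' → E' →L[ℝ] E' →L[ℝ] ℝ}
    {Γ : E' → E' →L[ℝ] E' →L[ℝ] E'}
    {F V W : E → E'} {t : E} (h : IsLocalLeviCivita G Γ (F t)) (hF : DifferentiableAt ℝ F t)
    (hV : DifferentiableAt ℝ V t) (hW : DifferentiableAt ℝ W t)
    (h0 : ∀ᶠ s in 𝓝 t, G (F s) (V s) (W s) = 0) (x : E) :
    G (F t) (alongDeriv Γ F V t x) (W t) = - G (F t) (V t) (alongDeriv Γ F W t x) := by
  have h1 := fderiv_metric_along h hF hV hW x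
  have h2 : (fun s ↦ G (F s) (V s) (W s)) =ᶠ[𝓝 t] fun _ ↦ 0 := h0
  rw [h2.fderiv_eq] at h1
  simp at h1
  linarith

lemma localCurvature_antisymm (Γ : E' → E' →L[ℝ] E' →L[ℝ] E') (y c b a : E') :
    localCurvature Γ y c b a = - localCurvature Γ y b c a := by
  simp only [localCurvature]
  abel

/-- Torsion-freeness makes `Γ`, and after differentiation also its derivative, symmetric in the last
two arguments; the terms of the cyclic sum then cancel in pairs. -/
lemma localCurvature_bianchi {G : E' → E' →L[ℝ] E' →L[ℝ] ℝ} {Γ : E' → E' →L[ℝ] E' →L[ℝ] E'}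
    {y : E'} (h : IsLocalLeviCivita G Γ y) (c b a : E') :
    localCurvature Γ y c b a + localCurvature Γ y b a c + localCurvature Γ y a c b = 0 := by
  have hs : ∀ u v w, fderiv ℝ Γ y u v w = fderiv ℝ Γ y u w v := by
    intro u v w
    have hΓ : DifferentiableAt ℝ Γ y := h.smooth_symbols.differentiableAt (by simp)
    have e : (fun s ↦ Γ s v w) =ᶠ[𝓝 y] fun s ↦ Γ s w v := by
      filter_upwards [h.torsion_free] with s hs using hs v w
    have := congr($(e.fderiv_eq (𝕜 := ℝ)) u)
    rw [fderiv_clm_apply₂ hΓ (differentiableAt_const v) (differentiableAt_const w),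
      fderiv_clm_apply₂ hΓ (differentiableAt_const w) (differentiableAt_const v)] at this
    simpa using this
  have ht := h.torsion_free.self_of_nhds
  simp only [localCurvature]
  rw [hs c a b, hs b c a, hs a b c, ht a b, ht b c, ht c a]
  abel

-- Differentiating metric compatibility once more expresses the second derivative of `G` through
-- `Γ`. It is symmetric in the two directions `c` and `v`; in the antisymmetric part the mixed
-- products `G (Γ a v) (Γ b c)` drop out and the two curvature terms remain.
set_option maxSynthPendingDepth 3 in
lemma localCurvature_skew {G : E' → E' →L[ℝ] E' →L[ℝ] ℝ} {Γ : E' → E' →L[ℝ] E' →L[ℝ] E'}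
    {y : E'} (h : IsLocalLeviCivita G Γ y) (c v a b : E') :
    G y (localCurvature Γ y c v a) b = - G y (localCurvature Γ y c v b) a := by
  have hG : DifferentiableAt ℝ G y := h.smooth_metric.differentiableAt (by simp)
  have hΓ : DifferentiableAt ℝ Γ y := h.smooth_symbols.differentiableAt (by simp)
  have hdG : DifferentiableAt ℝ (fderiv ℝ G) y :=
    (contDiffAt_fderiv h.smooth_metric).differentiableAt (by simp)
  have hc := h.compatible.self_of_nhds
  have key : ∀ c v, fderiv ℝ (fderiv ℝ G) y c v a b =
      G y (Γ y (Γ y a v) c) b + G y (Γ y a v) (Γ y b c) + G y (fderiv ℝ Γ y c a v) b +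
      (G y (Γ y a c) (Γ y b v) + G y a (Γ y (Γ y b v) c) + G y a (fderiv ℝ Γ y c b v)) := by
    intro c v
    have e : (fun s ↦ fderiv ℝ G s v a b) =ᶠ[𝓝 y]
        fun s ↦ G s (Γ s a v) b + G s a (Γ s b v) := by
      filter_upwards [h.compatible] with s hs using hs v a b
    have hΓ1 : ∀ w, DifferentiableAt ℝ (fun s ↦ Γ s w v) y := fun w ↦
      (hΓ.clm_apply (differentiableAt_const w)).clm_apply (differentiableAt_const v)
    have hΓ2 : ∀ w, fderiv ℝ (fun s ↦ Γ s w v) y c = fderiv ℝ Γ y c w v := by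
      intro w
      rw [fderiv_clm_apply₂ hΓ (differentiableAt_const w) (differentiableAt_const v)]
      simp
    have e2 := congr($(e.fderiv_eq (𝕜 := ℝ)) c)
    rw [fderiv_clm_apply₂ (hdG.clm_apply (differentiableAt_const v)) (differentiableAt_const a)
      (differentiableAt_const b), fderiv_clm_apply hdG (differentiableAt_const v),
      fderiv_fun_add ((hG.clm_apply (hΓ1 a)).clm_apply (differentiableAt_const b))
        ((hG.clm_apply (differentiableAt_const a)).clm_apply (hΓ1 b)),
      add_apply (fderiv ℝ _ y) (fderiv ℝ _ y),
      fderiv_clm_apply₂ hG (hΓ1 a) (differentiableAt_const b),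
      fderiv_clm_apply₂ hG (differentiableAt_const a) (hΓ1 b), hΓ2, hΓ2] at e2
    simp at e2
    rw [hc, hc] at e2
    linarith
  have hsymm := fderiv_fderiv_symm h.smooth_metric c v
  have e := congr($hsymm a b)
  rw [key, key] at e
  rw [h.metric_symm y _ a]
  simp only [localCurvature, map_add, map_sub, add_apply,
    sub_apply]
  linarith

/-- If the directions of a parametrized leaf are null for the metric induced by `F`, the second
fundamental form of `F` with respect to the leaf directions is symmetric. -/
lemma metric_localHessian_leaf_symm {G : E' → E' →L[ℝ] E' →L[ℝ] ℝ}
    {Γ : E' → E' →L[ℝ] E' →L[ℝ] E'} {F : E → E'} {k : E'' → E} {s₀ : E''}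
    (h : IsLocalLeviCivita G Γ (F (k s₀))) (hF : ContDiffAt ℝ ∞ F (k s₀))
    (hk : ContDiffAt ℝ ∞ k s₀)
    (h0 : ∀ᶠ s in 𝓝 s₀, ∀ v y, G (F (k s)) (fderiv ℝ F (k s) (fderiv ℝ k s v))
      (fderiv ℝ F (k s) y) = 0) (v w : E'') (y : E) :
    G (F (k s₀)) (localHessian Γ F (k s₀) (fderiv ℝ k s₀ v) y)
        (fderiv ℝ F (k s₀) (fderiv ℝ k s₀ w)) =
      G (F (k s₀)) (localHessian Γ F (k s₀) (fderiv ℝ k s₀ w) y)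
        (fderiv ℝ F (k s₀) (fderiv ℝ k s₀ v)) := by
  have hFk : ContDiffAt ℝ ∞ (F ∘ k) s₀ := hF.comp s₀ hk
  have hk' : DifferentiableAt ℝ k s₀ := hk.differentiableAt (by simp)
  have hdF : DifferentiableAt ℝ (fderiv ℝ F) (k s₀) :=
    (contDiffAt_fderiv hF).differentiableAt (by simp)
  have hdFk : DifferentiableAt ℝ (fderiv ℝ (F ∘ k)) s₀ :=
    (contDiffAt_fderiv hFk).differentiableAt (by simp)
  have hchain : ∀ᶠ s in 𝓝 s₀, fderiv ℝ (F ∘ k) s = (fderiv ℝ F (k s)).comp (fderiv ℝ k s) := by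
    filter_upwards [eventually_differentiableAt hk,
      hk.continuousAt.eventually (eventually_differentiableAt hF)] with s hs hs'
    exact fderiv_comp s hs' hs
  have hW : DifferentiableAt ℝ (fun s ↦ fderiv ℝ F (k s) y) s₀ :=
    (hdF.comp s₀ hk').clm_apply (differentiableAt_const y)
  have h1 : fderiv ℝ (fun s ↦ fderiv ℝ F (k s) y) s₀ =
      (fderiv ℝ (fderiv ℝ F) (k s₀)).flip y ∘L fderiv ℝ k s₀ := by
    ext x
    rw [fderiv_clm_apply (c := fun s ↦ fderiv ℝ F (k s)) (hdF.comp s₀ hk')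
      (differentiableAt_const y), show (fun s ↦ fderiv ℝ F (k s)) = fderiv ℝ F ∘ k from rfl,
      fderiv_comp s₀ hdF hk']
    simp
  -- The leaf direction `v` stays orthogonal to the image of `y` along the leaf. Differentiating
  -- this along `w` moves the Hessian onto `F ∘ k`, where it is symmetric in `v` and `w`.
  have key : ∀ v w, G (F (k s₀)) (localHessian Γ F (k s₀) (fderiv ℝ k s₀ w) y)
        (fderiv ℝ F (k s₀) (fderiv ℝ k s₀ v)) =
      - G (F (k s₀)) (localHessian Γ (F ∘ k) s₀ w v) (fderiv ℝ F (k s₀) y) := by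
    intro v w
    have e := metric_alongDeriv_of_orthogonal (F := F ∘ k) (G := G)
      (V := fun s ↦ fderiv ℝ (F ∘ k) s v) (W := fun s ↦ fderiv ℝ F (k s) y) (t := s₀) h
      (hFk.differentiableAt (by simp)) (hdFk.clm_apply (differentiableAt_const v)) hW
      (by filter_upwards [h0, hchain] with s hs hs'
          rw [hs']
          exact hs v y) w
    rw [alongDeriv_fderiv_apply (Y := fun _ ↦ v) hFk (differentiableAt_const v)] at e
    simp only [fderiv_fun_const, Pi.zero_apply, zero_apply, map_zero,
      add_zero] at e
    rw [alongDeriv, h1, hchain.self_of_nhds] at e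
    simp only [Function.comp_apply, ContinuousLinearMap.comp_apply,
      ContinuousLinearMap.flip_apply] at e
    rw [e, neg_neg, h.metric_symm]
    rfl
  rw [key, key, localHessian_symm (F := F ∘ k) (G := G) h hFk]

end LocalCalculus

/-! ### Tangent vectors, vector fields and brackets in a chart. -/

section TangentCoordinates

open Filter Topology Bundle

variable {E : Type*} [NormedAddCommGroup E] [NormedSpace ℝ E]
  {H : Type*} [TopologicalSpace H] {I : ModelWithCorners ℝ E H}
  {M : Type*} [TopologicalSpace M] [ChartedSpace H M] [IsManifold I ∞ M]
  {W : Type*} [NormedAddCommGroup W] [NormedSpace ℝ W]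

variable (I) in
/-- The components of tangent vectors at `x` in the chart at `x₀`. -/
noncomputable def coord (x₀ x : M) : TangentSpace I x →L[ℝ] E :=
  (trivializationAt E (TangentSpace I : M → Type _) x₀).continuousLinearMapAt ℝ x

variable (I) in
/-- The tangent vector at `x` with given components in the chart at `x₀`. -/
noncomputable def ofCoord (x₀ x : M) : E →L[ℝ] TangentSpace I x :=
  (trivializationAt E (TangentSpace I : M → Type _) x₀).symmL ℝ x

lemma coord_apply {x₀ x : M} (hx : x ∈ (chartAt H x₀).source) (v : TangentSpace I x) :
    coord I x₀ x v = (trivializationAt E (TangentSpace I : M → Type _) x₀ ⟨x, v⟩).2 :=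
  Trivialization.continuousLinearMapAt_apply_of_mem ℝ _ hx v

lemma ofCoord_apply {x₀ x : M} (hx : x ∈ (chartAt H x₀).source) (v : E) :
    ofCoord I x₀ x v = (trivializationAt E (TangentSpace I : M → Type _) x₀).symm x v :=
  Trivialization.symmL_apply _ hx v

@[simp]
lemma coord_ofCoord {x₀ x : M} (hx : x ∈ (chartAt H x₀).source) (v : E) :
    coord I x₀ x (ofCoord I x₀ x v) = v :=
  Trivialization.continuousLinearMapAt_symmL _ hx v

@[simp]
lemma ofCoord_coord {x₀ x : M} (hx : x ∈ (chartAt H x₀).source) (v : TangentSpace I x) :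
    ofCoord I x₀ x (coord I x₀ x v) = v :=
  Trivialization.symmL_continuousLinearMapAt _ hx v

lemma coord_eq_mfderiv {x₀ x : M} (hx : x ∈ (chartAt H x₀).source) :
    coord I x₀ x = mfderiv I 𝓘(ℝ, E) (extChartAt I x₀) x :=
  TangentBundle.continuousLinearMapAt_trivializationAt hx

lemma ofCoord_eq_mfderivWithin {x₀ x : M} (hx : x ∈ (chartAt H x₀).source) :
    ofCoord I x₀ x = mfderivWithin 𝓘(ℝ, E) I (extChartAt I x₀).symm (Set.range I)
      (extChartAt I x₀ x) :=
  TangentBundle.symmL_trivializationAt hx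

lemma extend_eq_ofCoord {x y : M} (v : TangentSpace I x) (hy : y ∈ (chartAt H x).source) :
    FiberBundle.extend E v y = ofCoord I x y (coord I x x v) := by
  rw [coord_apply (mem_chart_source H x), ofCoord_apply hy]
  rfl

lemma eventually_mem_chart_source (x : M) : ∀ᶠ y in 𝓝 x, y ∈ (chartAt H x).source :=
  (chartAt H x).open_source.mem_nhds (mem_chart_source H x)

lemma eventually_mem_chart_source' {x₀ x : M} (hx : x ∈ (chartAt H x₀).source) :
    ∀ᶠ y in 𝓝 x, y ∈ (chartAt H x₀).source :=
  (chartAt H x₀).open_source.mem_nhds hx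

/-- The differential of a vector valued function in the chart at `x₀`. -/
lemma hasFDerivAt_chart [I.Boundaryless] {a : M → W} {x₀ x : M} (hx : x ∈ (chartAt H x₀).source)
    (ha : MDifferentiableAt I 𝓘(ℝ, W) a x) :
    HasFDerivAt (a ∘ (extChartAt I x₀).symm) (mvfderiv I a x ∘L ofCoord I x₀ x)
      (extChartAt I x₀ x) := by
  have hx' : x ∈ (extChartAt I x₀).source := by simpa using hx
  have h1 : HasMFDerivAt 𝓘(ℝ, E) I (extChartAt I x₀).symm (extChartAt I x₀ x)
      (ofCoord I x₀ x) := by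
    rw [ofCoord_eq_mfderivWithin hx, I.range_eq_univ, mfderivWithin_univ]
    have h := mdifferentiableWithinAt_extChartAt_symm (I := I) ((extChartAt I x₀).map_source hx')
    rw [I.range_eq_univ, mdifferentiableWithinAt_univ] at h
    exact h.hasMFDerivAt
  have h2 : HasMFDerivAt I 𝓘(ℝ, W) a ((extChartAt I x₀).symm (extChartAt I x₀ x))
      (mfderiv I 𝓘(ℝ, W) a x) := by
    rw [(extChartAt I x₀).left_inv hx']
    exact ha.hasMFDerivAt
  exact (HasMFDerivAt.comp (extChartAt I x₀ x) h2 h1).hasFDerivAt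

lemma mvfderiv_eq_fderiv [I.Boundaryless] {a : M → W} {x₀ x : M}
    (hx : x ∈ (chartAt H x₀).source)
    (ha : MDifferentiableAt I 𝓘(ℝ, W) a x) (v : TangentSpace I x) :
    mvfderiv I a x v =
      fderiv ℝ (a ∘ (extChartAt I x₀).symm) (extChartAt I x₀ x) (coord I x₀ x v) := by
  rw [(hasFDerivAt_chart hx ha).fderiv, ContinuousLinearMap.comp_apply, ofCoord_coord hx]

lemma mdifferentiableAt_of_chart {a : M → W} {x₀ x : M}
    (hx : x ∈ (chartAt H x₀).source)
    (ha : DifferentiableAt ℝ (a ∘ (extChartAt I x₀).symm) (extChartAt I x₀ x)) :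
    MDifferentiableAt I 𝓘(ℝ, W) a x := by
  have h1 : MDifferentiableAt I 𝓘(ℝ, E) (extChartAt I x₀) x := mdifferentiableAt_extChartAt hx
  refine (ha.mdifferentiableAt.comp x h1).congr_of_eventuallyEq ?_
  filter_upwards [eventually_mem_chart_source' hx] with y hy
  exact congrArg a ((extChartAt I x₀).left_inv (by simpa using hy)).symm

lemma contDiffAt_chart [I.Boundaryless] {a : M → W} {x₀ : M} (ha : ContMDiffAt I 𝓘(ℝ, W) ∞ a x₀) :
    ContDiffAt ℝ ∞ (a ∘ (extChartAt I x₀).symm) (extChartAt I x₀ x₀) := by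
  have h := contMDiffWithinAt_extChartAt_symm_range (I := I) (n := ∞) x₀
    (mem_extChartAt_target (I := I) x₀)
  rw [I.range_eq_univ, contMDiffWithinAt_univ] at h
  rw [← contMDiffAt_iff_contDiffAt]
  exact ContMDiffAt.comp_of_eq ha h (by simp)

lemma mdifferentiableAt_field_iff {X : Π x : M, TangentSpace I x} {x₀ x : M}
    (hx : x ∈ (chartAt H x₀).source) :
    MDifferentiableAt I I.tangent (fun y ↦ (⟨y, X y⟩ : TangentBundle I M)) x ↔
      MDifferentiableAt I 𝓘(ℝ, E) (fun y ↦ coord I x₀ y (X y)) x := by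
  have h := (trivializationAt E (TangentSpace I : M → Type _) x₀).mdifferentiableAt_section_iff
    I X (b₀ := x) hx
  refine h.trans (Filter.EventuallyEq.mdifferentiableAt_iff ?_)
  filter_upwards [eventually_mem_chart_source' hx] with y hy
  rw [coord_apply hy]

lemma mdifferentiableAt_ofCoord {x₀ x : M} (hx : x ∈ (chartAt H x₀).source) (w : E) :
    MDifferentiableAt I I.tangent (fun y ↦ (⟨y, ofCoord I x₀ y w⟩ : TangentBundle I M)) x := by
  rw [mdifferentiableAt_field_iff (X := fun y ↦ ofCoord I x₀ y w) hx]
  refine (mdifferentiableAt_const (c := w)).congr_of_eventuallyEq ?_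
  filter_upwards [eventually_mem_chart_source' hx] with y hy
  rw [coord_ofCoord hy]

lemma contMDiffOn_ofCoord (x₀ : M) (w : E) :
    ContMDiffOn I I.tangent ∞ (fun y ↦ (⟨y, ofCoord I x₀ y w⟩ : TangentBundle I M))
      (chartAt H x₀).source := by
  have h := (trivializationAt E (TangentSpace I : M → Type _) x₀).contMDiffOn_section_baseSet_iff
    (n := ∞) (IB := I) (s := fun y ↦ ofCoord I x₀ y w)
  refine h.2 ((contMDiffOn_const (c := w)).congr fun y hy ↦ ?_)
  exact (coord_apply hy _).symm.trans (coord_ofCoord hy w)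

lemma mlieBracket_modelSpace (X Y : Π y : E, TangentSpace 𝓘(ℝ, E) y) :
    VectorField.mlieBracket 𝓘(ℝ, E) X Y = VectorField.lieBracket ℝ X Y := by
  rw [← VectorField.mlieBracketWithin_univ, VectorField.mlieBracketWithin_eq_lieBracketWithin]
  exact VectorField.lieBracketWithin_univ

/-- The Lie bracket of vector fields in the chart at `x₀`. -/
lemma coord_mlieBracket [I.Boundaryless] [CompleteSpace E] {X Y : Π x : M, TangentSpace I x} {x₀ x : M}
    {X' Y' : E → E}
    (hx : x ∈ (chartAt H x₀).source)
    (hX : ∀ᶠ y in 𝓝 x, X y = ofCoord I x₀ y (X' (extChartAt I x₀ y)))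
    (hY : ∀ᶠ y in 𝓝 x, Y y = ofCoord I x₀ y (Y' (extChartAt I x₀ y)))
    (hX' : DifferentiableAt ℝ X' (extChartAt I x₀ x))
    (hY' : DifferentiableAt ℝ Y' (extChartAt I x₀ x)) :
    coord I x₀ x (VectorField.mlieBracket I X Y x) =
      fderiv ℝ Y' (extChartAt I x₀ x) (X' (extChartAt I x₀ x)) -
        fderiv ℝ X' (extChartAt I x₀ x) (Y' (extChartAt I x₀ x)) := by
  -- A field is the pullback under the chart of its coordinate expression, and brackets commute with
  -- pullbacks.
  have hpull : ∀ (Z : Π x : M, TangentSpace I x) (Z' : Π y : E, TangentSpace 𝓘(ℝ, E) y),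
      (∀ᶠ y in 𝓝 x, Z y = ofCoord I x₀ y (Z' (extChartAt I x₀ y))) →
      Z =ᶠ[𝓝 x] VectorField.mpullback I 𝓘(ℝ, E) (extChartAt I x₀) Z' := by
    intro Z Z' hZ
    filter_upwards [hZ, eventually_mem_chart_source' hx] with y hy hys
    have hys' : y ∈ (extChartAt I x₀).source := by simpa using hys
    have hi := isInvertible_mfderiv_extChartAt hys'
    have e : mfderiv I 𝓘(ℝ, E) (extChartAt I x₀) y (Z y) = Z' (extChartAt I x₀ y) := by
      rw [← coord_eq_mfderiv hys, hy]
      exact coord_ofCoord (E := E) hys _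
    exact (hi.inverse_apply_self (Z y)).symm.trans (congrArg _ e)
  have hmd : ∀ Z' : Π y : E, TangentSpace 𝓘(ℝ, E) y, DifferentiableAt ℝ (Z' : E → E) (extChartAt I x₀ x) →
      MDifferentiableAt 𝓘(ℝ, E) 𝓘(ℝ, E).tangent
        (fun y ↦ (⟨y, Z' y⟩ : TangentBundle 𝓘(ℝ, E) E)) (extChartAt I x₀ x) := by
    intro Z' hZ'
    rw [mdifferentiableAt_section]
    simpa using hZ'.mdifferentiableAt
  have hx' : x ∈ (extChartAt I x₀).source := by simpa using hx
  have h2 : minSmoothness ℝ 2 ≤ (∞ : ℕ∞ω) := by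
    rw [minSmoothness_of_isRCLikeNormedField]
    exact WithTop.coe_le_coe.2 (le_top : (2 : ℕ∞) ≤ ⊤)
  have : IsManifold I (minSmoothness ℝ 2) M := IsManifold.of_le h2
  rw [(hpull X X' hX).mlieBracket_vectorField_eq (hpull Y Y' hY),
    ← VectorField.mpullback_mlieBracket (n := ∞) (hmd X' hX') (hmd Y' hY')
      (contMDiffAt_extChartAt' hx) h2,
    VectorField.mpullback_apply, coord_eq_mfderiv hx]
  refine ((isInvertible_mfderiv_extChartAt hx').self_apply_inverse _).trans ?_
  exact congrFun (mlieBracket_modelSpace X' Y') (extChartAt I x₀ x)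

end TangentCoordinates

/-! ### Locality and the chain rule for derivatives of vector-valued functions. -/

section

open Filter Topology

variable {E : Type*} [NormedAddCommGroup E] [NormedSpace ℝ E]
  {H : Type*} [TopologicalSpace H] {I : ModelWithCorners ℝ E H}
  {M : Type*} [TopologicalSpace M] [ChartedSpace H M]
  {E' : Type*} [NormedAddCommGroup E'] [NormedSpace ℝ E']
  {H' : Type*} [TopologicalSpace H'] {I' : ModelWithCorners ℝ E' H'}
  {N : Type*} [TopologicalSpace N] [ChartedSpace H' N]
  {W : Type*} [NormedAddCommGroup W] [NormedSpace ℝ W]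

lemma mvfderiv_congr {a b : M → W} {q : M} (h : a =ᶠ[𝓝 q] b) (x : TangentSpace I q) :
    mvfderiv I a q x = mvfderiv I b q x := by
  have e : (mfderiv I 𝓘(ℝ, W) a q x : W) = mfderiv I 𝓘(ℝ, W) b q x :=
    congr($(h.mfderiv_eq (I := I) (I' := 𝓘(ℝ, W))) x)
  exact e

lemma mvfderiv_comp_apply' {a : N → W} {f : M → N} {q : M}
    (ha : MDifferentiableAt I' 𝓘(ℝ, W) a (f q)) (hf : MDifferentiableAt I I' f q)
    (x : TangentSpace I q) :
    mvfderiv I (fun p ↦ a (f p)) q x = mvfderiv I' a (f q) (mfderiv I I' f q x) :=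
  mfderiv_comp_apply q ha hf x

end

/-! ### Covariant derivatives in a chart, and change of chart. -/

section CovariantDerivativeCoordinates

open Filter Topology Bundle

variable {E : Type*} [NormedAddCommGroup E] [NormedSpace ℝ E]
  {H : Type*} [TopologicalSpace H] {I : ModelWithCorners ℝ E H}
  {M : Type*} [TopologicalSpace M] [ChartedSpace H M] [IsManifold I ∞ M]
  {E' : Type*} [NormedAddCommGroup E'] [NormedSpace ℝ E'] [FiniteDimensional ℝ E']
  {H' : Type*} [TopologicalSpace H'] {I' : ModelWithCorners ℝ E' H'}
  {N : Type*} [TopologicalSpace N] [ChartedSpace H' N] [IsManifold I' ∞ N]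
  {W : Type*} [NormedAddCommGroup W] [NormedSpace ℝ W]
  {W' : Type*} [NormedAddCommGroup W'] [NormedSpace ℝ W']

lemma mvfderiv_clm_apply [I.Boundaryless] {A : M → W →L[ℝ] W'} {a : M → W} {q : M}
    (hA : MDifferentiableAt I 𝓘(ℝ, W →L[ℝ] W') A q) (ha : MDifferentiableAt I 𝓘(ℝ, W) a q)
    (x : TangentSpace I q) :
    mvfderiv I (fun p ↦ A p (a p)) q x = mvfderiv I A q x (a q) + A q (mvfderiv I a q x) := by
  have hq := mem_chart_source H q
  have hq' : (extChartAt I q).symm (extChartAt I q q) = q := by simp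
  rw [mvfderiv_eq_fderiv hq (hA.clm_apply ha), mvfderiv_eq_fderiv hq hA,
    mvfderiv_eq_fderiv hq ha]
  have e := fderiv_clm_apply (hasFDerivAt_chart hq hA).differentiableAt
    (hasFDerivAt_chart hq ha).differentiableAt
  change fderiv ℝ (fun t ↦ (A ∘ (extChartAt I q).symm) t ((a ∘ (extChartAt I q).symm) t)) _ _ = _
  rw [e]
  simp [add_comm]

/-- A covariant derivative in the chart at the base point. -/
lemma covariantDerivative_eq_extend (nabla : CovariantDerivative I' E' (TangentSpace I' : N → Type _))
    {σ : Π z : N, TangentSpace I' z} {z : N}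
    (hσ : MDifferentiableAt I' I'.tangent (fun y ↦ (⟨y, σ y⟩ : TangentBundle I' N)) z)
    (v : TangentSpace I' z) :
    nabla σ z v = ofCoord I' z z (mvfderiv I' (fun y ↦ coord I' z y (σ y)) z v) +
      nabla (FiberBundle.extend E' (σ z)) z v := by
  have hz := mem_chart_source H' z
  -- The connection minus the derivative of components is tensorial, so it sees only the value `σ
  -- z`. It can be evaluated on the extension with constant coefficients, whose components have
  -- derivative zero.
  let Φ : (Π y : N, TangentSpace I' y) → (TangentSpace I' z →L[ℝ] TangentSpace I' z) :=
    fun τ ↦ nabla τ z - ofCoord I' z z ∘L mvfderiv I' (fun y ↦ coord I' z y (τ y)) z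
  have hΦ : TensorialAt I' E' Φ z := by
    constructor
    · intro f τ hf hτ
      have hτ' := (mdifferentiableAt_field_iff hz).1 hτ
      have e : (fun y ↦ coord I' z y ((f • τ) y)) = f • fun y ↦ coord I' z y (τ y) := by
        ext y
        simp
      simp only [Φ]
      rw [nabla.isCovariantDerivativeOnUniv.leibniz hτ hf, e, mvfderiv_smul hf hτ']
      ext w
      simp [ofCoord_coord hz, smul_sub]
    · intro τ τ' hτ hτ'
      have e : (fun y ↦ coord I' z y ((τ + τ') y)) =
          (fun y ↦ coord I' z y (τ y)) + fun y ↦ coord I' z y (τ' y) := by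
        ext y
        simp
      simp only [Φ]
      rw [nabla.isCovariantDerivativeOnUniv.add hτ hτ', e,
        mvfderiv_add ((mdifferentiableAt_field_iff hz).1 hτ)
          ((mdifferentiableAt_field_iff hz).1 hτ')]
      ext w
      simp
      abel
  have h := hΦ.pointwise hσ (FiberBundle.mdifferentiableAt_extend I' E' (σ z)) (by simp)
  have h0 : mvfderiv I' (fun y ↦ coord I' z y (FiberBundle.extend E' (σ z) y)) z v = 0 := by
    rw [mvfderiv_congr (b := fun _ ↦ coord I' z z (σ z)), mvfderiv_const]
    · rfl
    · filter_upwards [eventually_mem_chart_source (H := H') z] with y hy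
      rw [extend_eq_ofCoord _ hy, coord_ofCoord hy]
  have h' := congr($h v)
  simp only [Φ, sub_apply, ContinuousLinearMap.comp_apply, h0, map_zero, sub_zero] at h'
  rw [← h']
  abel

omit [FiniteDimensional ℝ E'] in
lemma mdifferentiableAt_coordChange {z₀ z : N} (hz : z ∈ (chartAt H' z₀).source) :
    MDifferentiableAt I' 𝓘(ℝ, E' →L[ℝ] E') (fun y ↦ (coord I' z y ∘L ofCoord I' z₀ y : E' →L[ℝ] E'))
      z := by
  have h := contMDiffOn_coordChangeL (IB := I') (n := 1)
    (trivializationAt E' (TangentSpace I' : N → Type _) z₀)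
    (trivializationAt E' (TangentSpace I' : N → Type _) z)
  have hU : (trivializationAt E' (TangentSpace I' : N → Type _) z₀).baseSet ∩
      (trivializationAt E' (TangentSpace I' : N → Type _) z).baseSet ∈ 𝓝 z :=
    (((chartAt H' z₀).open_source.inter (chartAt H' z).open_source).mem_nhds
      ⟨hz, mem_chart_source H' z⟩)
  refine ((h.contMDiffAt hU).mdifferentiableAt (by simp)).congr_of_eventuallyEq ?_
  filter_upwards [hU] with y hy
  ext w
  rw [ContinuousLinearMap.comp_apply, coord_apply hy.2, ofCoord_apply hy.1]
  exact ((Trivialization.coordChangeL_apply _ _ hy w)).symm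

/-- The covariant derivative of a vector field along a map, in an arbitrary chart. -/
lemma covDerivAlong_eq [I.Boundaryless] [I'.Boundaryless]
    (nabla : CovariantDerivative I' E' (TangentSpace I' : N → Type _)) {f : M → N}
    {V : Π q : M, TangentSpace I' (f q)} {z₀ : N} {q : M}
    (hq : f q ∈ (chartAt H' z₀).source) (hf : MDifferentiableAt I I' f q)
    (hV : MDifferentiableAt I 𝓘(ℝ, E') (fun p ↦ coord I' z₀ (f p) (V p)) q)
    (x : TangentSpace I q) :
    covDerivAlong nabla f V q x =
      ofCoord I' z₀ (f q) (mvfderiv I (fun p ↦ coord I' z₀ (f p) (V p)) q x) +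
      nabla (fun z ↦ ofCoord I' z₀ z (coord I' z₀ (f q) (V q))) (f q) (mfderiv I I' f q x) := by
  have hz := mem_chart_source H' (f q)
  have hC := mdifferentiableAt_coordChange (I' := I') hq
  have hCf : MDifferentiableAt I 𝓘(ℝ, E' →L[ℝ] E')
      (fun p ↦ (coord I' (f q) (f p) ∘L ofCoord I' z₀ (f p) : E' →L[ℝ] E')) q :=
    MDifferentiableAt.comp q hC hf
  have h1 : mvfderiv I (fun p ↦ (trivializationAt E' (TangentSpace I' : N → Type _) (f q)
        (⟨f p, V p⟩ : TangentBundle I' N)).2) q x =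
      mvfderiv I (fun p ↦ (coord I' (f q) (f p) ∘L ofCoord I' z₀ (f p) : E' →L[ℝ] E')
        (coord I' z₀ (f p) (V p))) q x := by
    apply mvfderiv_congr
    filter_upwards [hf.continuousAt.eventually (eventually_mem_chart_source' hq),
      hf.continuousAt.eventually (eventually_mem_chart_source (H := H') (f q))] with p hp hp'
    rw [ContinuousLinearMap.comp_apply, ofCoord_coord hp, coord_apply hp']
  rw [covDerivAlong, h1, mvfderiv_clm_apply hCf hV, mvfderiv_comp_apply' hC hf,
    covariantDerivative_eq_extend nabla (mdifferentiableAt_ofCoord hq _), ofCoord_coord hq,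
    ← ofCoord_apply hz]
  -- The derivative of the transition matrix between the charts at `z₀` and `f q` occurs on both
  -- sides: on the left from the components of `V`, on the right from the connection applied to the
  -- constant frame of `z₀`.
  have h2 : ∀ (w : E') (v : TangentSpace I' (f q)),
      mvfderiv I' (fun y ↦ coord I' (f q) y (ofCoord I' z₀ y w)) (f q) v =
      mvfderiv I' (fun y ↦ (coord I' (f q) y ∘L ofCoord I' z₀ y : E' →L[ℝ] E')) (f q) v w := by
    intro w v
    have := mvfderiv_clm_apply hC (mdifferentiableAt_const (c := w)) v
    rw [mvfderiv_const] at this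
    simpa using this
  rw [h2, map_add, ContinuousLinearMap.comp_apply, ofCoord_coord hz]
  abel

end CovariantDerivativeCoordinates

/-! ### The metric and the Levi-Civita connection in a chart. -/

section LocalLeviCivita

open Filter Topology Bundle

lemma contDiffAt_clm_of_apply {D V W : Type*} [NormedAddCommGroup D] [NormedSpace ℝ D]
    [NormedAddCommGroup V] [NormedSpace ℝ V] [FiniteDimensional ℝ V]
    [NormedAddCommGroup W] [NormedSpace ℝ W] {f : D → V →L[ℝ] W} {x : D} {n : ℕ∞ω}
    (h : ∀ v, ContDiffAt ℝ n (fun y ↦ f y v) x) : ContDiffAt ℝ n f x := by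
  have hd : Module.finrank ℝ V = Module.finrank ℝ (Fin (Module.finrank ℝ V) → ℝ) :=
    (Module.finrank_fin_fun ℝ).symm
  let e₁ := ContinuousLinearEquiv.ofFinrankEq hd
  let e₂ := (e₁.arrowCongr (1 : W ≃L[ℝ] W)).trans
    (ContinuousLinearEquiv.piRing (Fin (Module.finrank ℝ V)))
  rw [← Function.id_comp f, ← e₂.symm_comp_self]
  exact e₂.symm.contDiff.contDiffAt.comp x (contDiffAt_pi.mpr fun i ↦ h _)

/-- A bilinear map on a finite dimensional space as a continuous bilinear map. -/
noncomputable def continuousBilinear {V W : Type*} [NormedAddCommGroup V] [NormedSpace ℝ V]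
    [FiniteDimensional ℝ V] [NormedAddCommGroup W] [NormedSpace ℝ W] (B : V →ₗ[ℝ] V →ₗ[ℝ] W) :
    V →L[ℝ] V →L[ℝ] W :=
  LinearMap.toContinuousLinearMap
    ((LinearMap.toContinuousLinearMap (𝕜 := ℝ) (E := V) (F' := W)).toLinearMap ∘ₗ B)

@[simp]
lemma continuousBilinear_apply {V W : Type*} [NormedAddCommGroup V] [NormedSpace ℝ V]
    [FiniteDimensional ℝ V] [NormedAddCommGroup W] [NormedSpace ℝ W] (B : V →ₗ[ℝ] V →ₗ[ℝ] W)
    (v w : V) : continuousBilinear B v w = B v w := rfl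

variable {E : Type*} [NormedAddCommGroup E] [NormedSpace ℝ E] [FiniteDimensional ℝ E]
  {H : Type*} [TopologicalSpace H] {I : ModelWithCorners ℝ E H}
  {M : Type*} [TopologicalSpace M] [ChartedSpace H M] [IsManifold I ∞ M]

/-- The components of the metric in the chart at `z₀`. -/
noncomputable def localMetric (g : SemiRiemannianMetric I M) (z₀ : M) (y : E) :
    E →L[ℝ] E →L[ℝ] ℝ :=
  let z := (extChartAt I z₀).symm y
  continuousBilinear ((g.val z).toBilinForm.compl₁₂ (ofCoord I z₀ z).toLinearMap
    (ofCoord I z₀ z).toLinearMap)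

lemma localMetric_apply (g : SemiRiemannianMetric I M) (z₀ : M) (y v w : E) :
    localMetric g z₀ y v w = g.val ((extChartAt I z₀).symm y)
      (ofCoord I z₀ _ v) (ofCoord I z₀ _ w) := rfl

lemma metric_eq_localMetric (g : SemiRiemannianMetric I M) {z₀ z : M}
    (hz : z ∈ (chartAt H z₀).source) (v w : TangentSpace I z) :
    g.val z v w = localMetric g z₀ (extChartAt I z₀ z) (coord I z₀ z v) (coord I z₀ z w) := by
  rw [localMetric_apply, (extChartAt I z₀).left_inv (by simpa using hz), ofCoord_coord hz,
    ofCoord_coord hz]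

omit [FiniteDimensional ℝ E] in
lemma contMDiffAt_metric_ofCoord (g : SemiRiemannianMetric I M) (z₀ : M) (v w : E) :
    ContMDiffAt I 𝓘(ℝ, ℝ) ∞ (fun z ↦ g.val z (ofCoord I z₀ z v) (ofCoord I z₀ z w)) z₀ := by
  have hU := eventually_mem_chart_source (H := H) z₀
  have h : ContMDiffAt I (I.prod 𝓘(ℝ)) ∞ (fun z ↦ TotalSpace.mk' ℝ (E := Bundle.Trivial M ℝ) z
      (g.val z (ofCoord I z₀ z v) (ofCoord I z₀ z w))) z₀ :=
    ContMDiffAt.clm_bundle_apply₂ (F₁ := E) (F₂ := E) g.contMDiff.contMDiffAt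
      ((contMDiffOn_ofCoord z₀ v).contMDiffAt hU) ((contMDiffOn_ofCoord z₀ w).contMDiffAt hU)
  simp only [contMDiffAt_totalSpace] at h
  exact h.2

lemma contDiffAt_localMetric [I.Boundaryless] (g : SemiRiemannianMetric I M) (z₀ : M) :
    ContDiffAt ℝ ∞ (localMetric g z₀) (extChartAt I z₀ z₀) :=
  contDiffAt_clm_of_apply fun v ↦ contDiffAt_clm_of_apply fun w ↦
    contDiffAt_chart (contMDiffAt_metric_ofCoord g z₀ v w)

open Classical in
/-- The Christoffel symbols of a covariant derivative in the chart at `z₀`. -/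
noncomputable def christoffel (nabla : CovariantDerivative I E (TangentSpace I : M → Type _))
    (z₀ : M) (y : E) : E →L[ℝ] E →L[ℝ] E :=
  let z := (extChartAt I z₀).symm y
  -- Linearity in `w` uses that the fields with constant coefficients are differentiable at `z`,
  -- which is available on the chart domain; the default value is not met near the base point.
  if hz : z ∈ (chartAt H z₀).source then
    continuousBilinear <| LinearMap.mk₂ ℝ
      (fun w v ↦ coord I z₀ z (nabla (fun p ↦ ofCoord I z₀ p w) z (ofCoord I z₀ z v)))
      (fun w w' v ↦ by
        have e : (fun p ↦ ofCoord I z₀ p (w + w')) =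
            (fun p ↦ ofCoord I z₀ p w) + fun p ↦ ofCoord I z₀ p w' := by
          ext p
          simp
        rw [e, nabla.isCovariantDerivativeOnUniv.add (mdifferentiableAt_ofCoord hz w)
          (mdifferentiableAt_ofCoord hz w')]
        simp)
      (fun c w v ↦ by
        have e : (fun p ↦ ofCoord I z₀ p (c • w)) = c • fun p ↦ ofCoord I z₀ p w := by
          ext p
          simp
        rw [e, nabla.isCovariantDerivativeOnUniv.smul_const c (mdifferentiableAt_ofCoord hz w)]
        simp)
      (fun w v v' ↦ by simp)
      (fun c w v ↦ by simp)
  else 0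

lemma christoffel_apply {nabla : CovariantDerivative I E (TangentSpace I : M → Type _)}
    {z₀ z : M} (hz : z ∈ (chartAt H z₀).source) (w : E) (v : TangentSpace I z) :
    christoffel nabla z₀ (extChartAt I z₀ z) w (coord I z₀ z v) =
      coord I z₀ z (nabla (fun p ↦ ofCoord I z₀ p w) z v) := by
  have hz' : (extChartAt I z₀).symm (extChartAt I z₀ z) = z :=
    (extChartAt I z₀).left_inv (by simpa using hz)
  simp only [christoffel]
  rw [dif_pos (by rwa [hz'])]
  rw [continuousBilinear_apply, LinearMap.mk₂_apply, hz', ofCoord_coord hz]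

lemma contDiffAt_christoffel [I.Boundaryless] [T2Space M]
    {nabla : CovariantDerivative I E (TangentSpace I : M → Type _)}
    (hn : CovariantDerivative.ContMDiffCovariantDerivative nabla ∞) (z₀ : M) :
    ContDiffAt ℝ ∞ (christoffel nabla z₀) (extChartAt I z₀ z₀) := by
  refine contDiffAt_clm_of_apply fun w ↦ contDiffAt_clm_of_apply fun v ↦ ?_
  have hU := eventually_mem_chart_source (H := H) z₀
  -- Smoothness of the connection speaks of globally smooth sections; a bump function turns the
  -- constant frame field of the chart into one.
  obtain ⟨χ, -, -⟩ := (SmoothBumpFunction.nhds_basis_tsupport (I := I) z₀).mem_iff.1 hU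
  have hσ : ContMDiff I I.tangent ∞
      (fun z ↦ (⟨z, ((χ : M → ℝ) • fun p ↦ ofCoord I z₀ p w) z⟩ : TangentBundle I M)) :=
    ContMDiffOn.smul_section_of_tsupport χ.contMDiff.contMDiffOn (chartAt H z₀).open_source
      χ.tsupport_subset_chartAt_source (contMDiffOn_ofCoord z₀ w)
  have h1 : ContMDiff I (I.prod 𝓘(ℝ, E →L[ℝ] E)) ∞
      (fun z ↦ (⟨z, nabla ((χ : M → ℝ) • fun p ↦ ofCoord I z₀ p w) z⟩ :
        TotalSpace (E →L[ℝ] E) fun x : M ↦ TangentSpace I x →L[ℝ] TangentSpace I x)) := by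
    rw [← contMDiffOn_univ]
    exact hn.contMDiff.contMDiff (by simpa using hσ.contMDiffOn)
  have h2 : ContMDiffAt I I.tangent ∞ (fun z ↦ (⟨z, nabla ((χ : M → ℝ) • fun p ↦ ofCoord I z₀ p w) z
      (ofCoord I z₀ z v)⟩ : TangentBundle I M)) z₀ :=
    ContMDiffAt.clm_bundle_apply (F₁ := E) (F₂ := E) h1.contMDiffAt
      ((contMDiffOn_ofCoord z₀ v).contMDiffAt hU)
  have h3 := (contMDiffAt_totalSpace.1 h2).2
  refine (contDiffAt_chart h3).congr_of_eventuallyEq ?_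
  have hc : Tendsto (extChartAt I z₀).symm (𝓝 (extChartAt I z₀ z₀)) (𝓝 z₀) := by
    simpa [ContinuousAt] using continuousAt_extChartAt_symm (I := I) z₀
  have hT : ∀ᶠ y in 𝓝 (extChartAt I z₀ z₀), y ∈ (extChartAt I z₀).target :=
    extChartAt_target_mem_nhds z₀
  -- The cutoff must equal `1` on a neighbourhood of each nearby `z`, because the connection depends
  -- on the germ of the field.
  have hχ : ∀ᶠ z in 𝓝 z₀, ∀ᶠ p in 𝓝 z, χ p = 1 := χ.eventuallyEq_one.eventually_nhds
  filter_upwards [hT, hc.eventually hχ] with y hy hy'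
  set z := (extChartAt I z₀).symm y with hz
  have hyz : y = extChartAt I z₀ z := ((extChartAt I z₀).right_inv hy).symm
  have hzs : z ∈ (chartAt H z₀).source := by
    rw [← extChartAt_source I]
    exact (extChartAt I z₀).map_target hy
  have e : nabla ((χ : M → ℝ) • fun p ↦ ofCoord I z₀ p w) z =
      nabla (fun p ↦ ofCoord I z₀ p w) z := by
    refine nabla.isCovariantDerivativeOnUniv.congr_of_eventuallyEq
      ((hσ.contMDiffAt).mdifferentiableAt (by simp)) (mdifferentiableAt_ofCoord hzs w)
      Filter.univ_mem ?_
    filter_upwards [hy'] with p hp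
    simp [hp]
  have hv : v = coord I z₀ z (ofCoord I z₀ z v) := (coord_ofCoord hzs v).symm
  simp only [Function.comp_apply]
  rw [← hz, e, ← coord_apply hzs]
  conv_lhs => rw [hyz, hv]
  rw [christoffel_apply hzs]

lemma mlieBracket_ofCoord [I.Boundaryless] {z₀ z : M}
    (hz : z ∈ (chartAt H z₀).source) (v w : E) :
    VectorField.mlieBracket I (fun p ↦ ofCoord I z₀ p v) (fun p ↦ ofCoord I z₀ p w) z = 0 := by
  have h := coord_mlieBracket (I := I) (X := fun p ↦ ofCoord I z₀ p v)
    (Y := fun p ↦ ofCoord I z₀ p w) (X' := fun _ ↦ v) (Y' := fun _ ↦ w) hz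
    (Eventually.of_forall fun _ ↦ rfl) (Eventually.of_forall fun _ ↦ rfl)
    (differentiableAt_const v) (differentiableAt_const w)
  rw [← ofCoord_coord hz (VectorField.mlieBracket I _ _ z), h]
  simp

-- Both identities are those of the connection tested on fields with constant coefficients in the
-- chart; the brackets of such fields vanish.
set_option synthInstance.maxHeartbeats 200000 in
theorem isLocalLeviCivita [I.Boundaryless] [T2Space M] {g : SemiRiemannianMetric I M}
    {nabla : CovariantDerivative I E (TangentSpace I : M → Type _)}
    (h : g.IsLeviCivita nabla) (z₀ : M) :
    IsLocalLeviCivita (localMetric g z₀) (christoffel nabla z₀) (extChartAt I z₀ z₀) := by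
  have hT : ∀ᶠ y in 𝓝 (extChartAt I z₀ z₀), y ∈ (extChartAt I z₀).target :=
    extChartAt_target_mem_nhds z₀
  have hG : ∀ᶠ y in 𝓝 (extChartAt I z₀ z₀), DifferentiableAt ℝ (localMetric g z₀) y :=
    eventually_differentiableAt (contDiffAt_localMetric g z₀)
  have pt : ∀ y ∈ (extChartAt I z₀).target, ∃ z ∈ (chartAt H z₀).source,
      y = extChartAt I z₀ z ∧ ∀ v, v = coord I z₀ z (ofCoord I z₀ z v) := by
    intro y hy
    have hz : (extChartAt I z₀).symm y ∈ (chartAt H z₀).source := by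
      simpa using (extChartAt I z₀).map_target hy
    exact ⟨_, hz, ((extChartAt I z₀).right_inv hy).symm, fun v ↦ (coord_ofCoord hz v).symm⟩
  refine ⟨contDiffAt_localMetric g z₀, contDiffAt_christoffel h.smooth z₀,
    fun y v w ↦ by rw [localMetric_apply, localMetric_apply, g.symm], ?_, ?_⟩
  · filter_upwards [hT] with y hy v w
    obtain ⟨z, hz, rfl, hc⟩ := pt y hy
    have e := (CovariantDerivative.torsion_eq_zero_iff nabla).1 h.torsion_free
      (mdifferentiableAt_ofCoord hz v) (mdifferentiableAt_ofCoord hz w)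
    rw [mlieBracket_ofCoord hz, sub_eq_zero] at e
    conv_lhs => rw [hc w]
    conv_rhs => rw [hc v]
    rw [christoffel_apply hz, christoffel_apply hz, e]
  · filter_upwards [hT, hG] with y hy hGy v a b
    obtain ⟨z, hz, rfl, hc⟩ := pt y hy
    have e := h.metric z (ofCoord I z₀ z v) _ _ (mdifferentiableAt_ofCoord hz a)
      (mdifferentiableAt_ofCoord hz b)
    have hd : DifferentiableAt ℝ (fun y ↦ localMetric g z₀ y a b) (extChartAt I z₀ z) :=
      (hGy.clm_apply (differentiableAt_const a)).clm_apply (differentiableAt_const b)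
    have e1 := mvfderiv_eq_fderiv hz (mdifferentiableAt_of_chart
      (a := fun z ↦ g.val z (ofCoord I z₀ z a) (ofCoord I z₀ z b)) hz hd) (ofCoord I z₀ z v)
    have e2 : fderiv ℝ (fun y ↦ localMetric g z₀ y a b) (extChartAt I z₀ z) v =
        fderiv ℝ (localMetric g z₀) (extChartAt I z₀ z) v a b := by
      rw [fderiv_clm_apply₂ hGy (differentiableAt_const a) (differentiableAt_const b)]
      simp
    rw [coord_ofCoord hz] at e1
    rw [← e2]
    refine (e1.symm.trans e).trans ?_
    rw [metric_eq_localMetric g hz, metric_eq_localMetric g hz, ← christoffel_apply hz,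
      ← christoffel_apply hz, coord_ofCoord hz, coord_ofCoord hz, coord_ofCoord hz]

end LocalLeviCivita

/-! ### Maps, fields along maps and curvature in charts. -/

section AlongCoordinates

open Filter Topology Bundle

variable {E : Type*} [NormedAddCommGroup E] [NormedSpace ℝ E]
  {H : Type*} [TopologicalSpace H] {I : ModelWithCorners ℝ E H}
  {M : Type*} [TopologicalSpace M] [ChartedSpace H M]
  {E' : Type*} [NormedAddCommGroup E'] [NormedSpace ℝ E']
  {H' : Type*} [TopologicalSpace H'] {I' : ModelWithCorners ℝ E' H'}
  {N : Type*} [TopologicalSpace N] [ChartedSpace H' N]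

lemma eventually_chart {P : M → Prop} {u : M} (h : ∀ᶠ q in 𝓝 u, P q) :
    ∀ᶠ t in 𝓝 (extChartAt I u u), P ((extChartAt I u).symm t) := by
  have hc : Tendsto (extChartAt I u).symm (𝓝 (extChartAt I u u)) (𝓝 u) := by
    simpa [ContinuousAt] using continuousAt_extChartAt_symm (I := I) u
  exact hc.eventually h

lemma eventually_of_eventually_chart {P : E → Prop} {u : M}
    (h : ∀ᶠ t in 𝓝 (extChartAt I u u), P t) : ∀ᶠ q in 𝓝 u, P (extChartAt I u q) :=
  (continuousAt_extChartAt (I := I) u).eventually h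

variable (I I') in
/-- The map `f` in the charts at `u` and `f u`. -/
noncomputable def localMap (f : M → N) (u : M) (t : E) : E' :=
  extChartAt I' (f u) (f ((extChartAt I u).symm t))

@[simp]
lemma localMap_self (f : M → N) (u : M) :
    localMap I I' f u (extChartAt I u u) = extChartAt I' (f u) (f u) := by
  simp [localMap]

lemma localMap_apply {f : M → N} {u q : M} (hq : q ∈ (chartAt H u).source) :
    localMap I I' f u (extChartAt I u q) = extChartAt I' (f u) (f q) := by
  rw [localMap, (extChartAt I u).left_inv (by rwa [extChartAt_source])]

variable [IsManifold I ∞ M] [IsManifold I' ∞ N]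

lemma contDiffAt_localMap [I.Boundaryless] {f : M → N} (hf : ContMDiff I I' ∞ f) (u : M) :
    ContDiffAt ℝ ∞ (localMap I I' f u) (extChartAt I u u) :=
  contDiffAt_chart (a := fun q ↦ extChartAt I' (f u) (f q))
    ((contMDiffAt_extChartAt (n := ∞) (x := f u)).comp u hf.contMDiffAt)

lemma fderiv_localMap [I.Boundaryless] {f : M → N} (hf : ContMDiff I I' ∞ f) {u q : M}
    (hq : q ∈ (chartAt H u).source) (hfq : f q ∈ (chartAt H' (f u)).source)
    (x : TangentSpace I q) :
    fderiv ℝ (localMap I I' f u) (extChartAt I u q) (coord I u q x) =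
      coord I' (f u) (f q) (mfderiv I I' f q x) := by
  have hfd : MDifferentiableAt I I' f q := (hf q).mdifferentiableAt (by simp)
  have hψ : MDifferentiableAt I' 𝓘(ℝ, E') (extChartAt I' (f u)) (f q) :=
    mdifferentiableAt_extChartAt hfq
  have h := mvfderiv_eq_fderiv (a := fun p ↦ extChartAt I' (f u) (f p)) hq (hψ.comp q hfd) x
  rw [coord_eq_mfderiv hfq]
  refine Eq.trans ?_ (mvfderiv_comp_apply' hψ hfd x)
  exact h.symm

variable (I) in
/-- The components of a vector field in the chart at `u`. -/
noncomputable def localField (X : Π q : M, TangentSpace I q) (u : M) (t : E) : E :=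
  coord I u ((extChartAt I u).symm t) (X ((extChartAt I u).symm t))

lemma localField_apply (X : Π q : M, TangentSpace I q) {u q : M} (hq : q ∈ (chartAt H u).source) :
    localField I X u (extChartAt I u q) = coord I u q (X q) := by
  rw [localField, (extChartAt I u).left_inv (by rwa [extChartAt_source])]

lemma localField_self (X : Π q : M, TangentSpace I q) (u : M) :
    localField I X u (extChartAt I u u) = coord I u u (X u) :=
  localField_apply X (mem_chart_source H u)

lemma contDiffAt_localField [I.Boundaryless] {X : Π q : M, TangentSpace I q} {U : Set M} {u : M}
    (hX : SmoothFieldOn X U) (hU : U ∈ 𝓝 u) :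
    ContDiffAt ℝ ∞ (localField I X u) (extChartAt I u u) := by
  have h := (contMDiffAt_totalSpace.1 (hX.contMDiffAt hU)).2
  refine (contDiffAt_chart h).congr_of_eventuallyEq ?_
  filter_upwards [eventually_chart (eventually_mem_chart_source (H := H) u)] with t ht
  exact coord_apply ht _

variable (I I') in
/-- The components of a vector field along `f` in the charts at `u` and `f u`. -/
noncomputable def localAlong (f : M → N) (V : Π q : M, TangentSpace I' (f q)) (u : M) (t : E) :
    E' :=
  coord I' (f u) (f ((extChartAt I u).symm t)) (V ((extChartAt I u).symm t))

lemma localAlong_apply {f : M → N} (V : Π q : M, TangentSpace I' (f q)) {u q : M}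
    (hq : q ∈ (chartAt H u).source) :
    localAlong I I' f V u (extChartAt I u q) = coord I' (f u) (f q) (V q) := by
  rw [localAlong, (extChartAt I u).left_inv (by rwa [extChartAt_source])]

lemma localAlong_self {f : M → N} (V : Π q : M, TangentSpace I' (f q)) (u : M) :
    localAlong I I' f V u (extChartAt I u u) = coord I' (f u) (f u) (V u) :=
  localAlong_apply V (mem_chart_source H u)

lemma contDiffAt_localAlong [I.Boundaryless] {f : M → N} {V : Π q : M, TangentSpace I' (f q)}
    {U : Set M} {u : M} (hf : ContMDiff I I' ∞ f)
    (hV : ContMDiffOn I I'.tangent ∞ (fun p ↦ (⟨f p, V p⟩ : TangentBundle I' N)) U)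
    (hU : U ∈ 𝓝 u) : ContDiffAt ℝ ∞ (localAlong I I' f V u) (extChartAt I u u) := by
  have h := (contMDiffAt_totalSpace.1 (hV.contMDiffAt hU)).2
  refine (contDiffAt_chart h).congr_of_eventuallyEq ?_
  filter_upwards [eventually_chart (hf.continuous.continuousAt.eventually
    (eventually_mem_chart_source (H := H') (f u)))] with t ht
  exact coord_apply ht _

/-- Near `u`, the map `f` is in the domains of the charts at `u` and `f u`. -/
lemma eventually_mem_charts {f : M → N} (hf : ContMDiff I I' ∞ f) (u : M) :
    ∀ᶠ q in 𝓝 u, q ∈ (chartAt H u).source ∧ f q ∈ (chartAt H' (f u)).source :=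
  (eventually_mem_chart_source u).and (hf.continuous.continuousAt.eventually
    (eventually_mem_chart_source (H := H') (f u)))

/-- An identity that holds near `u` holds near the origin of the chart at `u`. -/
lemma eventually_chart_of [I.Boundaryless] {P : E → Prop} {u : M}
    (h : ∀ᶠ q in 𝓝 u, P (extChartAt I u q)) : ∀ᶠ t in 𝓝 (extChartAt I u u), P t := by
  filter_upwards [eventually_chart h, extChartAt_target_mem_nhds (I := I) u] with t ht ht'
  rwa [(extChartAt I u).right_inv ht'] at ht

lemma localAlong_mfderiv [I.Boundaryless] {f : M → N} (hf : ContMDiff I I' ∞ f)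
    (Y : Π q : M, TangentSpace I q) (u : M) :
    localAlong I I' f (fun q ↦ mfderiv I I' f q (Y q)) u =ᶠ[𝓝 (extChartAt I u u)]
      fun t ↦ fderiv ℝ (localMap I I' f u) t (localField I Y u t) := by
  refine eventually_chart_of ?_
  filter_upwards [eventually_mem_charts hf u] with q hq
  rw [localAlong_apply _ hq.1, localField_apply _ hq.1, fderiv_localMap hf hq.1 hq.2]

lemma metric_eq_localMetric_along [FiniteDimensional ℝ E'] (g : SemiRiemannianMetric I' N)
    {f : M → N} {u q : M}
    (hq : q ∈ (chartAt H u).source) (hfq : f q ∈ (chartAt H' (f u)).source)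
    (v w : TangentSpace I' (f q)) :
    g.val (f q) v w = localMetric g (f u) (localMap I I' f u (extChartAt I u q))
      (coord I' (f u) (f q) v) (coord I' (f u) (f q) w) := by
  rw [localMap_apply hq, metric_eq_localMetric g hfq]

section

variable [FiniteDimensional ℝ E'] [I.Boundaryless] [I'.Boundaryless]
  (nabla : CovariantDerivative I' E' (TangentSpace I' : N → Type _))

/-- The bridge to `alongDeriv`. The charts stay fixed at `u` and `f u` while `q` varies, so that the
result can be differentiated again. -/
lemma coord_covDerivAlong {f : M → N} (hf : ContMDiff I I' ∞ f) {u q : M}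
    (hq : q ∈ (chartAt H u).source) (hfq : f q ∈ (chartAt H' (f u)).source)
    {V : Π q : M, TangentSpace I' (f q)}
    (hV : DifferentiableAt ℝ (localAlong I I' f V u) (extChartAt I u q)) (x : TangentSpace I q) :
    coord I' (f u) (f q) (covDerivAlong nabla f V q x) =
      alongDeriv (christoffel nabla (f u)) (localMap I I' f u) (localAlong I I' f V u)
        (extChartAt I u q) (coord I u q x) := by
  have hfd : MDifferentiableAt I I' f q := (hf q).mdifferentiableAt (by simp)
  have hV' : MDifferentiableAt I 𝓘(ℝ, E') (fun p ↦ coord I' (f u) (f p) (V p)) q :=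
    mdifferentiableAt_of_chart hq hV
  rw [covDerivAlong_eq nabla hfq hfd hV', map_add, coord_ofCoord hfq, ← christoffel_apply hfq,
    mvfderiv_eq_fderiv hq hV', alongDeriv, localMap_apply hq, localAlong_apply V hq,
    fderiv_localMap hf hq hfq]
  rfl

lemma localAlong_covDerivAlong {f : M → N} (hf : ContMDiff I I' ∞ f) {u : M}
    {V : Π q : M, TangentSpace I' (f q)}
    (hV : ContDiffAt ℝ ∞ (localAlong I I' f V u) (extChartAt I u u))
    (Y : Π q : M, TangentSpace I q) :
    localAlong I I' f (fun q ↦ covDerivAlong nabla f V q (Y q)) u =ᶠ[𝓝 (extChartAt I u u)]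
      fun t ↦ alongDeriv (christoffel nabla (f u)) (localMap I I' f u) (localAlong I I' f V u) t
        (localField I Y u t) := by
  refine eventually_chart_of ?_
  filter_upwards [eventually_mem_charts hf u,
    eventually_of_eventually_chart (eventually_differentiableAt hV)] with q hq hd
  rw [localAlong_apply _ hq.1, localField_apply _ hq.1, coord_covDerivAlong nabla hf hq.1 hq.2 hd]

lemma coord_covDerivAlong_self {f : M → N} (hf : ContMDiff I I' ∞ f) {u : M}
    {V : Π q : M, TangentSpace I' (f q)}
    (hV : ContDiffAt ℝ ∞ (localAlong I I' f V u) (extChartAt I u u)) (x : TangentSpace I u) :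
    coord I' (f u) (f u) (covDerivAlong nabla f V u x) =
      alongDeriv (christoffel nabla (f u)) (localMap I I' f u) (localAlong I I' f V u)
        (extChartAt I u u) (coord I u u x) :=
  coord_covDerivAlong nabla hf (mem_chart_source H u) (mem_chart_source H' (f u))
    (hV.differentiableAt (by simp)) x

lemma coord_mlieBracket_self [CompleteSpace E] {X Y : Π x : M, TangentSpace I x} {u : M}
    (hX : DifferentiableAt ℝ (localField I X u) (extChartAt I u u))
    (hY : DifferentiableAt ℝ (localField I Y u) (extChartAt I u u)) :
    coord I u u (VectorField.mlieBracket I X Y u) =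
      fderiv ℝ (localField I Y u) (extChartAt I u u) (localField I X u (extChartAt I u u)) -
        fderiv ℝ (localField I X u) (extChartAt I u u) (localField I Y u (extChartAt I u u)) := by
  have key : ∀ Z : Π x : M, TangentSpace I x,
      ∀ᶠ q in 𝓝 u, Z q = ofCoord I u q (localField I Z u (extChartAt I u q)) := by
    intro Z
    filter_upwards [eventually_mem_chart_source (H := H) u] with q hq
    rw [localField_apply _ hq, ofCoord_coord hq]
  exact coord_mlieBracket (mem_chart_source H u) (key X) (key Y) hX hY

end

/-- The curvature of a covariant derivative in the chart at `z`. -/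
theorem coord_curvatureAt [FiniteDimensional ℝ E] [I.Boundaryless] [T2Space M]
    {nabla : CovariantDerivative I E (TangentSpace I : M → Type _)}
    (hn : CovariantDerivative.ContMDiffCovariantDerivative nabla ∞) (z : M)
    (a b c : TangentSpace I z) :
    coord I z z (curvatureAt nabla z a b c) =
      localCurvature (christoffel nabla z) (extChartAt I z z) (coord I z z a) (coord I z z b)
        (coord I z z c) := by
  -- A vector field is a field along the identity map, and the derivative along the identity is the
  -- connection itself; the commutator formula for fields along a map then gives the curvature.
  have hf : ContMDiff I I ∞ (fun y : M ↦ y) := contMDiff_id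
  have hz := mem_chart_source H z
  have hfF := contDiffAt_localMap hf z
  have hΓ : ContDiffAt ℝ ∞ (christoffel nabla z)
      (localMap I I (fun y : M ↦ y) z (extChartAt I z z)) := by
    rw [localMap_self]
    exact contDiffAt_christoffel hn z
  have hsmooth : ∀ v : TangentSpace I z,
      ContDiffAt ℝ ∞ (localField I (FiberBundle.extend E v) z) (extChartAt I z z) := by
    intro v
    obtain ⟨U, hU, h⟩ := FiberBundle.exists_contMDiffOn_extend (k := ∞) I E v
    exact contDiffAt_localField h hU
  have hD : ∀ (σ : Π y : M, TangentSpace I y) (y : M) (v : TangentSpace I y),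
      MDifferentiableAt I I.tangent (fun p ↦ (⟨p, σ p⟩ : TangentBundle I M)) y →
      nabla σ y v = covDerivAlong nabla (fun y : M ↦ y) σ y v := by
    intro σ y v hσ
    have hy := mem_chart_source H y
    rw [covDerivAlong, covariantDerivative_eq_extend nabla hσ, ofCoord_apply hy,
      mvfderiv_congr (b := fun q ↦ (trivializationAt E (TangentSpace I : M → Type _) y
        (⟨q, σ q⟩ : TangentBundle I M)).2)]
    · rw [show mfderiv I I (fun y : M ↦ y) y = ContinuousLinearMap.id ℝ _ from mfderiv_id]
      rfl
    · filter_upwards [eventually_mem_chart_source (H := H) y] with p hp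
      rw [coord_apply hp]
  have hm : ∀ (σ : Π y : M, TangentSpace I y), ContDiffAt ℝ ∞ (localField I σ z) (extChartAt I z z) →
      ∀ᶠ y in 𝓝 z, MDifferentiableAt I I.tangent (fun p ↦ (⟨p, σ p⟩ : TangentBundle I M)) y := by
    intro σ hσ
    filter_upwards [eventually_mem_chart_source (H := H) z,
      eventually_of_eventually_chart (eventually_differentiableAt hσ)] with y hy hd
    rw [mdifferentiableAt_field_iff hy]
    exact mdifferentiableAt_of_chart hy hd
  have hstep : ∀ (σ Y : Π y : M, TangentSpace I y),
      ContDiffAt ℝ ∞ (localField I σ z) (extChartAt I z z) →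
      localField I (fun y ↦ nabla σ y (Y y)) z =ᶠ[𝓝 (extChartAt I z z)]
        fun t ↦ alongDeriv (christoffel nabla z) (localMap I I (fun y : M ↦ y) z)
          (localField I σ z) t (localField I Y z t) := by
    intro σ Y hσ
    refine EventuallyEq.trans ?_ (localAlong_covDerivAlong nabla hf (V := σ) hσ Y)
    refine eventually_chart_of ?_
    filter_upwards [eventually_mem_chart_source (H := H) z, hm σ hσ] with y hy hd
    rw [localField_apply _ hy, localAlong_apply _ hy, hD σ y _ hd]
  have hval : ∀ (σ : Π y : M, TangentSpace I y) (v : TangentSpace I z),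
      ContDiffAt ℝ ∞ (localField I σ z) (extChartAt I z z) →
      coord I z z (nabla σ z v) =
        alongDeriv (christoffel nabla z) (localMap I I (fun y : M ↦ y) z)
          (localField I σ z) (extChartAt I z z) (coord I z z v) := by
    intro σ v hσ
    rw [hD σ z v (hm σ hσ).self_of_nhds]
    exact coord_covDerivAlong_self nabla hf (V := σ) hσ v
  have hext : ∀ v : TangentSpace I z,
      localField I (FiberBundle.extend E v) z (extChartAt I z z) = coord I z z v := by
    intro v
    rw [localField_self, FiberBundle.extend_apply_self]
  have hdF : ∀ v : TangentSpace I z, fderiv ℝ (localMap I I (fun y : M ↦ y) z) (extChartAt I z z)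
      (coord I z z v) = coord I z z v := by
    intro v
    rw [fderiv_localMap hf hz hz,
      show mfderiv I I (fun y : M ↦ y) z = ContinuousLinearMap.id ℝ _ from mfderiv_id]
    rfl
  have hsm2 : ∀ v : TangentSpace I z, ContDiffAt ℝ ∞
      (localField I (fun y ↦ nabla (FiberBundle.extend E c) y (FiberBundle.extend E v y)) z)
      (extChartAt I z z) := fun v ↦
    (ContDiffAt.alongDeriv hΓ hfF (hsmooth c) (hsmooth v)).congr_of_eventuallyEq
      (hstep _ _ (hsmooth c))
  have hcomm := alongDeriv_commutator hΓ hfF (hsmooth c) ((hsmooth a).differentiableAt (by simp))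
    ((hsmooth b).differentiableAt (by simp))
  rw [← coord_mlieBracket_self ((hsmooth a).differentiableAt (by simp))
    ((hsmooth b).differentiableAt (by simp)), hext, hext, hext, hdF, hdF, localMap_self] at hcomm
  rw [← hcomm, curvatureAt, curvature]
  simp only [Pi.sub_apply, map_sub]
  rw [hval _ _ (hsm2 b), hval _ _ (hsm2 a), hval _ _ (hsmooth c), alongDeriv_congr (hstep _ _ (hsmooth c)),
    alongDeriv_congr (hstep _ _ (hsmooth c)), FiberBundle.extend_apply_self,
    FiberBundle.extend_apply_self]

end AlongCoordinates

/-! ### Linear algebra of curvature tensors. -/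

section Algebra

variable {V : Type*} [AddCommGroup V] [Module ℝ V]

/-- A function with the symmetries of a curvature tensor is symmetric under exchange of pairs. -/
lemma curvature_pair_symm {K : V → V → V → V → ℝ}
    (antisymm : ∀ x y z w, K x y z w = -K y x z w)
    (skew : ∀ x y z w, K x y z w = -K x y w z)
    (bianchi : ∀ x y z w, K x y z w + K y z x w + K z x y w = 0) (x y z w : V) :
    K x y z w = K z w x y := by
  -- The octahedron argument: the four Bianchi sums, one for each vector in the last slot, combine
  -- to the claim once terms differing by a swap inside a pair are identified.
  linarith [bianchi x y z w, bianchi y z w x, bianchi z w x y, bianchi w x y z,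
    antisymm x y z w, antisymm x y w z, antisymm z w x y, antisymm z w y x,
    antisymm y z x w, antisymm y z w x, antisymm x w y z, antisymm x w z y,
    antisymm x z y w, antisymm x z w y, antisymm y w x z, antisymm y w z x,
    skew x y z w, skew y x z w, skew z w x y, skew w z x y,
    skew y z x w, skew z y x w, skew x w y z, skew w x y z,
    skew x z y w, skew z x y w, skew y w x z, skew w y x z]

/-- A function of four vectors that is linear in each of them is a quadrilinear form. -/
lemma exists_quadrilinear {K : V → V → V → V → ℝ}
    (h₁ : ∀ y z w, IsLinearMap ℝ fun x ↦ K x y z w)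
    (h₂ : ∀ x z w, IsLinearMap ℝ fun y ↦ K x y z w)
    (h₃ : ∀ x y w, IsLinearMap ℝ fun z ↦ K x y z w)
    (h₄ : ∀ x y z, IsLinearMap ℝ fun w ↦ K x y z w) :
    ∃ F : V →ₗ[ℝ] V →ₗ[ℝ] V →ₗ[ℝ] V →ₗ[ℝ] ℝ, ∀ x y z w, F x y z w = K x y z w := by
  let A (x y : V) : V →ₗ[ℝ] V →ₗ[ℝ] ℝ := LinearMap.mk₂ ℝ (fun z w ↦ K x y z w)
    (fun z z' w ↦ (h₃ x y w).map_add z z') (fun c z w ↦ (h₃ x y w).map_smul c z)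
    (fun z w w' ↦ (h₄ x y z).map_add w w') (fun c z w ↦ (h₄ x y z).map_smul c w)
  refine ⟨LinearMap.mk₂ ℝ A (fun x x' y ↦ ?_) (fun c x y ↦ ?_) (fun x y y' ↦ ?_)
    (fun c x y ↦ ?_), fun x y z w ↦ rfl⟩
  · ext z w
    exact (h₁ y z w).map_add x x'
  · ext z w
    exact (h₁ y z w).map_smul c x
  · ext z w
    exact (h₂ x z w).map_add y y'
  · ext z w
    exact (h₂ x z w).map_smul c y

/-- The algebraic part of the Gauss equation: if `K` has the symmetries of a curvature tensor and
`K(x, Py)` preserves the complement `R` of the range of `P`, then `K(x, y, z, Pw)` plus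
Kulkarni-Nomizu products of symmetric forms is an algebraic curvature tensor. -/
lemma exists_isAlgebraicCurvatureTensor {ι : Type*} [Fintype ι] {K : V → V → V → V → ℝ}
    (linear : ∀ x y z, IsLinearMap ℝ (K x y z))
    (antisymm : ∀ x y z w, K x y z w = -K y x z w)
    (skew : ∀ x y z w, K x y z w = -K x y w z)
    (bianchi : ∀ x y z w, K x y z w + K y z x w + K z x y w = 0)
    (P : V →ₗ[ℝ] V) (R : Submodule ℝ V) (hP : ∀ y, y - P y ∈ R)
    (hol : ∀ x y, ∀ ζ ∈ R, ∀ z, K x (P y) ζ z = 0)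
    (φ : ι → ℝ) (b : ι → V →ₗ[ℝ] V →ₗ[ℝ] ℝ) (hb : ∀ i x y, b i x y = b i y x) :
    ∃ F : V →ₗ[ℝ] V →ₗ[ℝ] V →ₗ[ℝ] V →ₗ[ℝ] ℝ, IsAlgebraicCurvatureTensor F ∧
      ∀ x y z w, F x y z w =
        K x y z (P w) + ∑ i, φ i * (b i y z * b i x w - b i x z * b i y w) := by
  have pair := curvature_pair_symm antisymm skew bianchi
  -- Linearity is given in the last slot; skew-symmetry and pair symmetry carry it to the others.
  have l3 : ∀ x y w, IsLinearMap ℝ (fun z ↦ K x y z w) := fun x y w ↦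
    ⟨fun z z' ↦ by rw [skew x y z, skew x y z', skew x y, (linear x y w).map_add]; ring,
     fun c z ↦ by rw [skew x y z, skew x y, (linear x y w).map_smul, smul_neg]⟩
  have l1 : ∀ y z w, IsLinearMap ℝ (fun x ↦ K x y z w) := fun y z w ↦
    ⟨fun x x' ↦ by rw [pair x, pair x', pair, (l3 z w y).map_add],
     fun c x ↦ by rw [pair x, pair, (l3 z w y).map_smul]⟩
  have l2 : ∀ x z w, IsLinearMap ℝ (fun y ↦ K x y z w) := fun x z w ↦
    ⟨fun y y' ↦ by rw [pair x y, pair x y', pair, (linear z w x).map_add],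
     fun c y ↦ by rw [pair x y, pair, (linear z w x).map_smul]⟩
  have s1 : ∀ x y z w, K x y z w = K (P x) y z w + K (x - P x) y z w := fun x y z w ↦ by
    rw [← (l1 y z w).map_add, add_sub_cancel]
  have s3 : ∀ x y z w, K x y z w = K x y (P z) w + K x y (z - P z) w := fun x y z w ↦ by
    rw [← (l3 x y w).map_add, add_sub_cancel]
  have s4 : ∀ x y z w, K x y z w = K x y z (P w) + K x y z (w - P w) := fun x y z w ↦ by
    rw [← (linear x y z).map_add, add_sub_cancel]
  have hol' : ∀ x y, ∀ ζ ∈ R, ∀ z, K x (P y) z ζ = 0 := fun x y ζ hζ z ↦ by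
    rw [skew, hol x y ζ hζ, neg_zero]
  -- With a screen vector in the second slot, radical parts vanish in the third slot by `hol` and in
  -- the fourth by skew-symmetry.
  have red : ∀ x w z y, K x (P w) z y = K x (P w) (P z) (P y) := fun x w z y ↦ by
    rw [s3, hol x w _ (hP z), s4, hol' x w _ (hP y), add_zero, add_zero]
  -- Pair symmetry moves `P w` to the second slot, where `red` projects `x` and `y`. The radical
  -- part of `z` is killed after returning it to the third slot, behind the screen vector `P y`.
  have main : ∀ x y z w, K x y z (P w) = K (P x) (P y) (P z) (P w) := fun x y z w ↦ by
    have h : K (z - P z) (P w) (P x) (P y) = 0 := by rw [pair, hol _ _ _ (hP z)]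
    rw [pair, red, s1, h, add_zero, pair]
  obtain ⟨F, hF⟩ := exists_quadrilinear
    (K := fun x y z w ↦ K x y z (P w) + ∑ i, φ i * (b i y z * b i x w - b i x z * b i y w))
    (fun y z w ↦ ⟨fun x x' ↦ by
        simp only [(l1 y z (P w)).map_add, map_add, LinearMap.add_apply]
        rw [add_add_add_comm, ← Finset.sum_add_distrib]
        congr 1
        exact Finset.sum_congr rfl fun i _ ↦ by ring,
      fun c x ↦ by
        simp only [(l1 y z (P w)).map_smul, map_smul, LinearMap.smul_apply, smul_eq_mul]
        rw [mul_add, Finset.mul_sum]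
        congr 1
        exact Finset.sum_congr rfl fun i _ ↦ by ring⟩)
    (fun x z w ↦ ⟨fun y y' ↦ by
        simp only [(l2 x z (P w)).map_add, map_add, LinearMap.add_apply]
        rw [add_add_add_comm, ← Finset.sum_add_distrib]
        congr 1
        exact Finset.sum_congr rfl fun i _ ↦ by ring,
      fun c y ↦ by
        simp only [(l2 x z (P w)).map_smul, map_smul, LinearMap.smul_apply, smul_eq_mul]
        rw [mul_add, Finset.mul_sum]
        congr 1
        exact Finset.sum_congr rfl fun i _ ↦ by ring⟩)
    (fun x y w ↦ ⟨fun z z' ↦ by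
        simp only [(l3 x y (P w)).map_add, map_add]
        rw [add_add_add_comm, ← Finset.sum_add_distrib]
        congr 1
        exact Finset.sum_congr rfl fun i _ ↦ by ring,
      fun c z ↦ by
        simp only [(l3 x y (P w)).map_smul, map_smul, smul_eq_mul]
        rw [mul_add, Finset.mul_sum]
        congr 1
        exact Finset.sum_congr rfl fun i _ ↦ by ring⟩)
    (fun x y z ↦ ⟨fun w w' ↦ by
        simp only [map_add, (linear x y z).map_add]
        rw [add_add_add_comm, ← Finset.sum_add_distrib]
        congr 1
        exact Finset.sum_congr rfl fun i _ ↦ by ring,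
      fun c w ↦ by
        simp only [map_smul, (linear x y z).map_smul, smul_eq_mul]
        rw [mul_add, Finset.mul_sum]
        congr 1
        exact Finset.sum_congr rfl fun i _ ↦ by ring⟩)
  refine ⟨F, ⟨fun x y z w ↦ ?_, fun x y z w ↦ ?_, fun x y z w ↦ ?_⟩, hF⟩
  · rw [hF, hF, antisymm, neg_add, ← Finset.sum_neg_distrib]
    congr 1
    exact Finset.sum_congr rfl fun i _ ↦ by ring
  -- Of the three symmetries only this one uses the holonomy condition, through `main`: the form
  -- with `P` in the last slot alone is not visibly symmetric.
  · rw [hF, hF, main x, main z, pair]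
    congr 1
    refine Finset.sum_congr rfl fun i _ ↦ ?_
    rw [hb i z y, hb i w x, hb i z x, hb i w y]
    ring
  · rw [hF, hF, hF]
    have h : ∑ i, φ i * (b i y z * b i x w - b i x z * b i y w) +
        ∑ i, φ i * (b i z x * b i y w - b i y x * b i z w) +
        ∑ i, φ i * (b i x y * b i z w - b i z y * b i x w) = 0 := by
      rw [← Finset.sum_add_distrib, ← Finset.sum_add_distrib]
      refine Finset.sum_eq_zero fun i _ ↦ ?_
      rw [hb i y z, hb i x z, hb i y x]
      ring
    linarith [bianchi x y z (P w)]

end Algebra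

/-! ### Null frames and the decompositions at a point. -/

section Pointwise

variable {E : Type*} [NormedAddCommGroup E] [NormedSpace ℝ E] [FiniteDimensional ℝ E]
  {H : Type*} [TopologicalSpace H] {I : ModelWithCorners ℝ E H}
  {M : Type*} [TopologicalSpace M] [ChartedSpace H M] [IsManifold I ∞ M]
  {E' : Type*} [NormedAddCommGroup E'] [NormedSpace ℝ E'] [FiniteDimensional ℝ E']
  {H' : Type*} [TopologicalSpace H'] {I' : ModelWithCorners ℝ E' H'}
  {N : Type*} [TopologicalSpace N] [ChartedSpace H' N] [IsManifold I' ∞ N]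
  {g : SemiRiemannianMetric I' N} {f : M → N} {S : ScreenDistribution I g f} {r : ℕ}

lemma mem_radical_iff {p : M} {ζ : TangentSpace I p} :
    ζ ∈ radical g f p ↔ ∀ y, g.val (f p) (mfderiv I I' f p ζ) (mfderiv I I' f p y) = 0 := by
  rw [radical, LinearMap.mem_ker, LinearMap.ext_iff]
  rfl

lemma metric_radical {p : M} {ζ : TangentSpace I p} (hζ : ζ ∈ radical g f p)
    (y : TangentSpace I p) : g.val (f p) (mfderiv I I' f p y) (mfderiv I I' f p ζ) = 0 := by
  rw [g.symm]
  exact mem_radical_iff.1 hζ y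

lemma ScreenDistribution.sub_proj_mem (S : ScreenDistribution I g f) (p : M)
    (y : TangentSpace I p) : y - S.proj p y ∈ radical g f p :=
  Submodule.sub_projection_mem (S.isCompl p) y

lemma ScreenDistribution.proj_mem (S : ScreenDistribution I g f) (p : M)
    (y : TangentSpace I p) : S.proj p y ∈ S.fiber p :=
  Submodule.projection_apply_mem (S.isCompl p) y

lemma mfderiv_tangentialPart_mem (hf : Manifold.IsImmersion I I' ∞ f)
    (L : LightlikeTransversalBundle S r) (p : M) (v : TangentSpace I' (f p)) :
    v - mfderiv I I' f p (tangentialPart hf L p v) ∈ L.fiber p := by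
  have h := LinearMap.linearProjOfIsCompl_apply_left (L.fiber p) (mfderiv I I' f p).toLinearMap
    (injective_mfderiv_of_isImmersion hf p) (L.isCompl p) (tangentialPart hf L p v)
  rw [← LinearMap.ker_linearProjOfIsCompl (L.fiber p) (mfderiv I I' f p).toLinearMap
    (injective_mfderiv_of_isImmersion hf p) (L.isCompl p), LinearMap.mem_ker, map_sub]
  exact sub_eq_zero.2 h.symm

namespace IsNullFramePairOn

variable {L : ∀ p : M, Submodule ℝ (TangentSpace I' (f p))}
  {ξ : Fin r → Π p : M, TangentSpace I p} {ν : Fin r → Π p : M, TangentSpace I' (f p)} {U : Set M}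

lemma mem_radical (h : IsNullFramePairOn S L ξ ν U) {p : M} (hp : p ∈ U) (i : Fin r) :
    ξ i p ∈ radical g f p := by
  rw [← h.frame.span_eq p hp]
  exact Submodule.subset_span ⟨i, rfl⟩

/-- The components of a vector of the radical in the frame. -/
lemma radical_eq (h : IsNullFramePairOn S L ξ ν U) {p : M} (hp : p ∈ U) {ζ : TangentSpace I p}
    (hζ : ζ ∈ radical g f p) :
    ζ = ∑ i, g.val (f p) (mfderiv I I' f p ζ) (ν i p) • ξ i p := by
  rw [← h.frame.span_eq p hp, Submodule.mem_span_range_iff_exists_fun] at hζ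
  obtain ⟨c, rfl⟩ := hζ
  refine Finset.sum_congr rfl fun i _ ↦ ?_
  congr 1
  simp [h.dual p hp]

/-- The components of a vector of the transversal bundle in the frame. -/
lemma transversal_eq (h : IsNullFramePairOn S L ξ ν U) {p : M} (hp : p ∈ U)
    {l : TangentSpace I' (f p)} (hl : l ∈ L p) :
    l = ∑ i, g.val (f p) l (mfderiv I I' f p (ξ i p)) • ν i p := by
  rw [← h.span_eq p hp, Submodule.mem_span_range_iff_exists_fun] at hl
  obtain ⟨c, rfl⟩ := hl
  refine Finset.sum_congr rfl fun i _ ↦ ?_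
  congr 1
  have h' : ∀ j, g.val (f p) (ν j p) (mfderiv I I' f p (ξ i p)) = if i = j then 1 else 0 :=
    fun j ↦ by rw [g.symm, h.dual p hp]
  simp [h']

/-- Pairing with `ν i` kills the screen and reads off the coefficients of the radical part. The
formula is what makes the projection preserve smoothness. -/
lemma proj_eq (h : IsNullFramePairOn S L ξ ν U) {p : M} (hp : p ∈ U) (y : TangentSpace I p) :
    S.proj p y = y - ∑ i, g.val (f p) (mfderiv I I' f p y) (ν i p) • ξ i p := by
  have e := h.radical_eq hp (S.sub_proj_mem p y)
  rw [eq_sub_iff_add_eq', ← eq_sub_iff_add_eq, e]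
  refine Finset.sum_congr rfl fun i _ ↦ ?_
  rw [map_sub, map_sub, sub_apply, h.orthogonal_screen p hp i _ (S.proj_mem p y), sub_zero]

end IsNullFramePairOn

/-- Pairing with the radical vector `ξ i` kills every tangent vector and reads off the coefficient
of `ν i`. -/
lemma mfderiv_tangentialPart {hf : Manifold.IsImmersion I I' ∞ f}
    {L : LightlikeTransversalBundle S r} {ξ : Fin r → Π p : M, TangentSpace I p}
    {ν : Fin r → Π p : M, TangentSpace I' (f p)} {U : Set M}
    (h : IsNullFramePairOn S L.fiber ξ ν U) {p : M} (hp : p ∈ U) (v : TangentSpace I' (f p)) :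
    mfderiv I I' f p (tangentialPart hf L p v) =
      v - ∑ i, g.val (f p) v (mfderiv I I' f p (ξ i p)) • ν i p := by
  have e := h.transversal_eq hp (mfderiv_tangentialPart_mem hf L p v)
  rw [eq_sub_iff_add_eq', ← eq_sub_iff_add_eq, e]
  refine Finset.sum_congr rfl fun i _ ↦ ?_
  rw [map_sub, sub_apply, metric_radical (h.mem_radical hp i), sub_zero]

/-- The radical part of `w` does not contribute, and the screen is orthogonal to the transversal
bundle; so the tangential projection can be dropped at the price of projecting `w`. -/
lemma inducedMetric_tangentialPart {hf : Manifold.IsImmersion I I' ∞ f}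
    {L : LightlikeTransversalBundle S r} {ξ : Fin r → Π p : M, TangentSpace I p}
    {ν : Fin r → Π p : M, TangentSpace I' (f p)} {U : Set M}
    (h : IsNullFramePairOn S L.fiber ξ ν U) {p : M} (hp : p ∈ U) (v : TangentSpace I' (f p))
    (w : TangentSpace I p) :
    inducedMetric g f p (tangentialPart hf L p v) w =
      g.val (f p) v (mfderiv I I' f p (S.proj p w)) := by
  have e : inducedMetric g f p (tangentialPart hf L p v) w =
      g.val (f p) (mfderiv I I' f p (tangentialPart hf L p v)) (mfderiv I I' f p w) := rfl
  have e2 : w = S.proj p w + (w - S.proj p w) := by abel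
  rw [e, e2, map_add, map_add, metric_radical (S.sub_proj_mem p w), add_zero, ← e2,
    mfderiv_tangentialPart h hp, map_sub, sub_apply, sub_eq_self, map_sum,
    sum_apply]
  refine Finset.sum_eq_zero fun i _ ↦ ?_
  rw [map_smul, smul_apply, g.symm (f p) (ν i p), h.orthogonal_screen p hp i _ (S.proj_mem p w), smul_zero]

end Pointwise

/-! ### Covariant calculus of vector fields along `f`. -/

section AlongCalculus

open Filter Topology Bundle

variable {E : Type*} [NormedAddCommGroup E] [NormedSpace ℝ E]
  {H : Type*} [TopologicalSpace H] {I : ModelWithCorners ℝ E H}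
  {M : Type*} [TopologicalSpace M] [ChartedSpace H M] [IsManifold I ∞ M]
  {E' : Type*} [NormedAddCommGroup E'] [NormedSpace ℝ E']
  {H' : Type*} [TopologicalSpace H'] {I' : ModelWithCorners ℝ E' H'}
  {N : Type*} [TopologicalSpace N] [ChartedSpace H' N] [IsManifold I' ∞ N]

lemma coord_injective {x₀ x : M} (hx : x ∈ (chartAt H x₀).source) :
    Function.Injective (coord I x₀ x) :=
  Function.LeftInverse.injective (ofCoord_coord hx)

variable (I) in
/-- The vector field `X` is smooth at `u`. -/
def SmoothFieldAt (X : Π q : M, TangentSpace I q) (u : M) : Prop :=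
  ContDiffAt ℝ ∞ (localField I X u) (extChartAt I u u)

variable (I I') in
/-- The vector field `V` along `f` is smooth at `u`. -/
def SmoothAlongAt (f : M → N) (V : Π q : M, TangentSpace I' (f q)) (u : M) : Prop :=
  ContDiffAt ℝ ∞ (localAlong I I' f V u) (extChartAt I u u)

lemma localAlong_congr {f : M → N} {u : M} {V W : Π q : M, TangentSpace I' (f q)}
    (h : ∀ᶠ q in 𝓝 u, V q = W q) :
    localAlong I I' f V u =ᶠ[𝓝 (extChartAt I u u)] localAlong I I' f W u := by
  filter_upwards [eventually_chart h] with t ht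
  rw [localAlong, localAlong, ht]

lemma SmoothAlongAt.congr {f : M → N} {u : M} {V W : Π q : M, TangentSpace I' (f q)}
    (hV : SmoothAlongAt I I' f V u) (h : ∀ᶠ q in 𝓝 u, W q = V q) : SmoothAlongAt I I' f W u :=
  ContDiffAt.congr_of_eventuallyEq hV (localAlong_congr h)

lemma SmoothFieldAt.mfderiv [I.Boundaryless] {f : M → N} (hf : ContMDiff I I' ∞ f) {u : M}
    {Y : Π q : M, TangentSpace I q} (hY : SmoothFieldAt I Y u) :
    SmoothAlongAt I I' f (fun q ↦ mfderiv I I' f q (Y q)) u :=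
  ((contDiffAt_fderiv (contDiffAt_localMap hf u)).clm_apply hY).congr_of_eventuallyEq
    (localAlong_mfderiv hf Y u)

lemma localAlong_sub_sum_smul {ι : Type*} [Fintype ι] {f : M → N} {u : M}
    (V : Π q : M, TangentSpace I' (f q)) (a : ι → M → ℝ)
    (W : ι → Π q : M, TangentSpace I' (f q)) (t : E) :
    localAlong I I' f (fun q ↦ V q - ∑ i, a i q • W i q) u t =
      localAlong I I' f V u t -
        ∑ i, (a i ∘ (extChartAt I u).symm) t • localAlong I I' f (W i) u t := by
  rw [localAlong, map_sub, map_sum]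
  exact congrArg _ (Finset.sum_congr rfl fun i _ ↦ map_smul _ _ _)

lemma localField_sub_sum_smul {ι : Type*} [Fintype ι] {u : M}
    (V : Π q : M, TangentSpace I q) (a : ι → M → ℝ)
    (W : ι → Π q : M, TangentSpace I q) (t : E) :
    localField I (fun q ↦ V q - ∑ i, a i q • W i q) u t =
      localField I V u t -
        ∑ i, (a i ∘ (extChartAt I u).symm) t • localField I (W i) u t := by
  rw [localField, map_sub, map_sum]
  exact congrArg _ (Finset.sum_congr rfl fun i _ ↦ map_smul _ _ _)

lemma SmoothAlongAt.sub_sum_smul {ι : Type*} [Fintype ι] {f : M → N} {u : M}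
    {V : Π q : M, TangentSpace I' (f q)} {a : ι → M → ℝ}
    {W : ι → Π q : M, TangentSpace I' (f q)} (hV : SmoothAlongAt I I' f V u)
    (ha : ∀ i, ContDiffAt ℝ ∞ (a i ∘ (extChartAt I u).symm) (extChartAt I u u))
    (hW : ∀ i, SmoothAlongAt I I' f (W i) u) :
    SmoothAlongAt I I' f (fun q ↦ V q - ∑ i, a i q • W i q) u := by
  rw [SmoothAlongAt, funext (localAlong_sub_sum_smul V a W)]
  exact ContDiffAt.sub hV (ContDiffAt.sum fun i _ ↦ (ha i).smul (hW i))

lemma SmoothFieldAt.sub_sum_smul {ι : Type*} [Fintype ι] {u : M}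
    {V : Π q : M, TangentSpace I q} {a : ι → M → ℝ}
    {W : ι → Π q : M, TangentSpace I q} (hV : SmoothFieldAt I V u)
    (ha : ∀ i, ContDiffAt ℝ ∞ (a i ∘ (extChartAt I u).symm) (extChartAt I u u))
    (hW : ∀ i, SmoothFieldAt I (W i) u) :
    SmoothFieldAt I (fun q ↦ V q - ∑ i, a i q • W i q) u := by
  rw [SmoothFieldAt, funext (localField_sub_sum_smul V a W)]
  exact ContDiffAt.sub hV (ContDiffAt.sum fun i _ ↦ (ha i).smul (hW i))

lemma SmoothFieldAt.congr {u : M} {V W : Π q : M, TangentSpace I q}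
    (hV : SmoothFieldAt I V u) (h : ∀ᶠ q in 𝓝 u, W q = V q) : SmoothFieldAt I W u := by
  refine ContDiffAt.congr_of_eventuallyEq hV ?_
  filter_upwards [eventually_chart h] with t ht
  rw [localField, localField, ht]

variable [I.Boundaryless] [I'.Boundaryless] [FiniteDimensional ℝ E'] [T2Space N]
  {g : SemiRiemannianMetric I' N} {nabla : CovariantDerivative I' E' (TangentSpace I' : N → Type _)}
  {f : M → N}

lemma isLocalLeviCivita_localMap (hn : g.IsLeviCivita nabla) (f : M → N) (u : M) :
    IsLocalLeviCivita (localMetric g (f u)) (christoffel nabla (f u))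
      (localMap I I' f u (extChartAt I u u)) := by
  rw [localMap_self]
  exact isLocalLeviCivita hn (f u)

lemma metric_eventuallyEq (hf : ContMDiff I I' ∞ f) (V W : Π q : M, TangentSpace I' (f q)) (u : M) :
    (fun q ↦ g.val (f q) (V q) (W q)) ∘ (extChartAt I u).symm =ᶠ[𝓝 (extChartAt I u u)]
      fun t ↦ localMetric g (f u) (localMap I I' f u t) (localAlong I I' f V u t)
        (localAlong I I' f W u t) := by
  refine eventually_chart_of ?_
  filter_upwards [eventually_mem_charts hf u] with q hq
  rw [localAlong_apply _ hq.1, localAlong_apply _ hq.1, Function.comp_apply,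
    (extChartAt I u).left_inv (by simpa using hq.1), metric_eq_localMetric_along (I := I) g hq.1 hq.2]

lemma metric_self (u : M) (v w : TangentSpace I' (f u)) :
    g.val (f u) v w = localMetric g (f u) (localMap I I' f u (extChartAt I u u))
      (coord I' (f u) (f u) v) (coord I' (f u) (f u) w) :=
  metric_eq_localMetric_along (I := I) g (mem_chart_source H u) (mem_chart_source H' (f u)) v w

lemma SmoothAlongAt.metric (hn : g.IsLeviCivita nabla) (hf : ContMDiff I I' ∞ f)
    {V W : Π q : M, TangentSpace I' (f q)} {u : M}
    (hV : SmoothAlongAt I I' f V u) (hW : SmoothAlongAt I I' f W u) :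
    ContDiffAt ℝ ∞ ((fun q ↦ g.val (f q) (V q) (W q)) ∘ (extChartAt I u).symm)
      (extChartAt I u u) := by
  refine ContDiffAt.congr_of_eventuallyEq ?_ (metric_eventuallyEq hf V W u)
  exact ((ContDiffAt.comp _ (isLocalLeviCivita_localMap hn f u).smooth_metric
    (contDiffAt_localMap hf u)).clm_apply hV).clm_apply hW

lemma SmoothAlongAt.covDerivAlong (hn : g.IsLeviCivita nabla) (hf : ContMDiff I I' ∞ f)
    {V : Π q : M, TangentSpace I' (f q)} {u : M} {Y : Π q : M, TangentSpace I q}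
    (hV : SmoothAlongAt I I' f V u) (hY : SmoothFieldAt I Y u) :
    SmoothAlongAt I I' f (fun q ↦ CoisotropicGeometry.covDerivAlong nabla f V q (Y q)) u :=
  (ContDiffAt.alongDeriv (isLocalLeviCivita_localMap hn f u).smooth_symbols
    (contDiffAt_localMap hf u) hV hY).congr_of_eventuallyEq
    (localAlong_covDerivAlong nabla hf hV Y)

lemma covDerivAlong_congr (hf : ContMDiff I I' ∞ f) {u : M}
    {V W : Π q : M, TangentSpace I' (f q)} (hW : SmoothAlongAt I I' f W u)
    (h : ∀ᶠ q in 𝓝 u, V q = W q) (x : TangentSpace I u) :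
    covDerivAlong nabla f V u x = covDerivAlong nabla f W u x := by
  apply coord_injective (mem_chart_source H' (f u))
  rw [coord_covDerivAlong_self nabla hf hW, coord_covDerivAlong_self nabla hf (hW.congr h),
    alongDeriv_congr (localAlong_congr h)]

/-- The `c i` are the derivatives of the `a i`. They may stay unnamed: in the Gauss equation they
multiply transversal vectors, which are then paired with the screen. -/
lemma covDerivAlong_sub_sum_smul {ι : Type*} [Fintype ι] (hf : ContMDiff I I' ∞ f) {u : M}
    {V : Π q : M, TangentSpace I' (f q)} {a : ι → M → ℝ}
    {W : ι → Π q : M, TangentSpace I' (f q)} (hV : SmoothAlongAt I I' f V u)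
    (ha : ∀ i, ContDiffAt ℝ ∞ (a i ∘ (extChartAt I u).symm) (extChartAt I u u))
    (hW : ∀ i, SmoothAlongAt I I' f (W i) u) (x : TangentSpace I u) :
    ∃ c : ι → ℝ, covDerivAlong nabla f (fun q ↦ V q - ∑ i, a i q • W i q) u x =
      covDerivAlong nabla f V u x -
        ∑ i, (c i • W i u + a i u • covDerivAlong nabla f (W i) u x) := by
  refine ⟨fun i ↦ fderiv ℝ (a i ∘ (extChartAt I u).symm) (extChartAt I u u) (coord I u u x), ?_⟩
  apply coord_injective (mem_chart_source H' (f u))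
  have hd : ∀ i, DifferentiableAt ℝ (localAlong I I' f (W i) u) (extChartAt I u u) :=
    fun i ↦ ContDiffAt.differentiableAt (hW i) (by simp)
  have had : ∀ i, DifferentiableAt ℝ (a i ∘ (extChartAt I u).symm) (extChartAt I u u) :=
    fun i ↦ (ha i).differentiableAt (by simp)
  rw [coord_covDerivAlong_self nabla hf (hV.sub_sum_smul ha hW), map_sub, map_sum,
    coord_covDerivAlong_self nabla hf hV, funext (localAlong_sub_sum_smul V a W),
    alongDeriv_sub_sum (ContDiffAt.differentiableAt hV (by simp))
      (fun i ↦ (had i).fun_smul (hd i))]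
  congr 1
  refine Finset.sum_congr rfl fun i _ ↦ ?_
  rw [alongDeriv_smul_fun (had i) (hd i), map_add, map_smul, map_smul,
    coord_covDerivAlong_self nabla hf (hW i), localAlong_self]
  simp

/-- Compatibility of the connection with the metric, for orthogonal vector fields along `f`. -/
lemma metric_covDerivAlong_of_orthogonal (hn : g.IsLeviCivita nabla) (hf : ContMDiff I I' ∞ f)
    {V W : Π q : M, TangentSpace I' (f q)} {u : M}
    (hV : SmoothAlongAt I I' f V u) (hW : SmoothAlongAt I I' f W u)
    (h : ∀ᶠ q in 𝓝 u, g.val (f q) (V q) (W q) = 0) (x : TangentSpace I u) :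
    g.val (f u) (covDerivAlong nabla f V u x) (W u) =
      -g.val (f u) (V u) (covDerivAlong nabla f W u x) := by
  rw [metric_self (I := I), metric_self (I := I), coord_covDerivAlong_self nabla hf hV,
    coord_covDerivAlong_self nabla hf hW, ← localAlong_self (I := I) V, ← localAlong_self (I := I) W]
  refine metric_alongDeriv_of_orthogonal (isLocalLeviCivita_localMap hn f u)
    ((contDiffAt_localMap hf u).differentiableAt (by simp))
    (ContDiffAt.differentiableAt hV (by simp)) (ContDiffAt.differentiableAt hW (by simp)) ?_ _
  filter_upwards [metric_eventuallyEq (g := g) hf V W u, eventually_chart h] with t ht ht'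
  rw [← ht]
  exact ht'

/-- The Ricci identity for vector fields along `f`. -/
lemma covDerivAlong_commutator [FiniteDimensional ℝ E] (hn : g.IsLeviCivita nabla)
    (hf : ContMDiff I I' ∞ f) {V : Π q : M, TangentSpace I' (f q)} {u : M}
    {X Y : Π q : M, TangentSpace I q} (hV : SmoothAlongAt I I' f V u)
    (hX : SmoothFieldAt I X u) (hY : SmoothFieldAt I Y u) :
    covDerivAlong nabla f (fun q ↦ covDerivAlong nabla f V q (Y q)) u (X u) -
      covDerivAlong nabla f (fun q ↦ covDerivAlong nabla f V q (X q)) u (Y u) -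
      covDerivAlong nabla f V u (VectorField.mlieBracket I X Y u) =
    curvatureAt nabla (f u) (mfderiv I I' f u (X u)) (mfderiv I I' f u (Y u)) (V u) := by
  have hX' := ContDiffAt.differentiableAt hX (by simp)
  have hY' := ContDiffAt.differentiableAt hY (by simp)
  apply coord_injective (mem_chart_source H' (f u))
  rw [coord_curvatureAt hn.smooth, map_sub, map_sub,
    coord_covDerivAlong_self nabla hf (hV.covDerivAlong hn hf hX),
    coord_covDerivAlong_self nabla hf (hV.covDerivAlong hn hf hY),
    coord_covDerivAlong_self nabla hf hV, coord_mlieBracket_self hX' hY',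
    alongDeriv_congr (localAlong_covDerivAlong nabla hf hV Y),
    alongDeriv_congr (localAlong_covDerivAlong nabla hf hV X), ← localField_self,
    ← localField_self, alongDeriv_commutator (isLocalLeviCivita_localMap hn f u).smooth_symbols
      (contDiffAt_localMap hf u) hV hX' hY', localField_self, localField_self,
    fderiv_localMap hf (mem_chart_source H u) (mem_chart_source H' (f u)),
    fderiv_localMap hf (mem_chart_source H u) (mem_chart_source H' (f u)), localAlong_self,
    localMap_self]

end AlongCalculus

/-! ### The second fundamental forms in radical directions. -/

section HessianForm

open Filter Topology Bundle

variable {E : Type*} [NormedAddCommGroup E] [NormedSpace ℝ E] [FiniteDimensional ℝ E]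
  {H : Type*} [TopologicalSpace H] {I : ModelWithCorners ℝ E H}
  {M : Type*} [TopologicalSpace M] [ChartedSpace H M] [IsManifold I ∞ M]
  {E' : Type*} [NormedAddCommGroup E'] [NormedSpace ℝ E'] [FiniteDimensional ℝ E']
  {H' : Type*} [TopologicalSpace H'] {I' : ModelWithCorners ℝ E' H'}
  {N : Type*} [TopologicalSpace N] [ChartedSpace H' N] [IsManifold I' ∞ N]

variable (I) in
/-- The second fundamental form of `f` at `u` in the direction of a vector `ζ` of the radical:
the component along `df ζ` of the Hessian of `f`. -/
noncomputable def hessianForm (g : SemiRiemannianMetric I' N)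
    (nabla : CovariantDerivative I' E' (TangentSpace I' : N → Type _)) (f : M → N) (u : M)
    (ζ : TangentSpace I u) : TangentSpace I u →ₗ[ℝ] TangentSpace I u →ₗ[ℝ] ℝ :=
  LinearMap.mk₂ ℝ (fun x y ↦ localMetric g (f u) (localMap I I' f u (extChartAt I u u))
    (localHessian (christoffel nabla (f u)) (localMap I I' f u) (extChartAt I u u)
      (coord I u u x) (coord I u u y)) (coord I' (f u) (f u) (mfderiv I I' f u ζ)))
    (fun x x' y ↦ by simp only [localHessian, map_add, add_apply]; ring)
    (fun c x y ↦ by simp only [localHessian, map_smul, map_add, add_apply, smul_apply, smul_eq_mul]; ring)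
    (fun x y y' ↦ by simp only [localHessian, map_add, add_apply]; ring)
    (fun c x y ↦ by simp only [localHessian, map_smul, map_add, add_apply, smul_apply, smul_eq_mul]; ring)

lemma hessianForm_apply (g : SemiRiemannianMetric I' N)
    (nabla : CovariantDerivative I' E' (TangentSpace I' : N → Type _)) (f : M → N) (u : M)
    (ζ x y : TangentSpace I u) : hessianForm I g nabla f u ζ x y =
      localMetric g (f u) (localMap I I' f u (extChartAt I u u))
        (localHessian (christoffel nabla (f u)) (localMap I I' f u) (extChartAt I u u)
          (coord I u u x) (coord I u u y)) (coord I' (f u) (f u) (mfderiv I I' f u ζ)) := rfl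

variable [I.Boundaryless] [I'.Boundaryless] [T2Space N]
  {g : SemiRiemannianMetric I' N} {nabla : CovariantDerivative I' E' (TangentSpace I' : N → Type _)}
  {f : M → N}

lemma hessianForm_symm (hn : g.IsLeviCivita nabla) (hf : ContMDiff I I' ∞ f) {u : M}
    (ζ x y : TangentSpace I u) :
    hessianForm I g nabla f u ζ x y = hessianForm I g nabla f u ζ y x := by
  rw [hessianForm_apply, hessianForm_apply, localHessian_symm (isLocalLeviCivita_localMap hn f u)
    (contDiffAt_localMap hf u)]

/-- Differentiating `Y` itself contributes a tangent vector, orthogonal to the radical. Hence only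
the value `Y u` matters: the second fundamental form is tensorial. -/
lemma metric_covDerivAlong_mfderiv (hf : ContMDiff I I' ∞ f) {u : M}
    {Y : Π q : M, TangentSpace I q} (hY : SmoothFieldAt I Y u) {ζ : TangentSpace I u}
    (hζ : ζ ∈ radical g f u) (x : TangentSpace I u) :
    g.val (f u) (covDerivAlong nabla f (fun q ↦ mfderiv I I' f q (Y q)) u x)
      (mfderiv I I' f u ζ) = hessianForm I g nabla f u ζ x (Y u) := by
  have h0 := metric_radical hζ (ofCoord I u u (fderiv ℝ (localField I Y u) (extChartAt I u u)
    (coord I u u x)))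
  rw [metric_self (I := I), ← fderiv_localMap hf (mem_chart_source H u) (mem_chart_source H' (f u)),
    coord_ofCoord (mem_chart_source H u)] at h0
  rw [metric_self (I := I), coord_covDerivAlong_self nabla hf (hY.mfderiv hf),
    alongDeriv_congr (localAlong_mfderiv hf Y u), alongDeriv_fderiv_apply (contDiffAt_localMap hf u)
      (ContDiffAt.differentiableAt hY (by simp)), map_add, add_apply, h0, add_zero,
      hessianForm_apply, localField_self]

/-- The second fundamental forms in the directions of the radical are skew on the radical. -/
lemma hessianForm_skew (hn : g.IsLeviCivita nabla) (hf : ContMDiff I I' ∞ f) {u : M}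
    {ξ η : Π q : M, TangentSpace I q} (hξ : SmoothFieldAt I ξ u) (hη : SmoothFieldAt I η u)
    (hξ' : ∀ᶠ q in 𝓝 u, ξ q ∈ radical g f q) (hη' : ∀ᶠ q in 𝓝 u, η q ∈ radical g f q)
    (x : TangentSpace I u) :
    hessianForm I g nabla f u (ξ u) x (η u) = -hessianForm I g nabla f u (η u) x (ξ u) := by
  rw [← metric_covDerivAlong_mfderiv hf hη hξ'.self_of_nhds,
    ← metric_covDerivAlong_mfderiv hf hξ hη'.self_of_nhds,
    metric_covDerivAlong_of_orthogonal hn hf (hη.mfderiv hf) (hξ.mfderiv hf), g.symm]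
  filter_upwards [hξ'] with q hq using metric_radical hq _

omit [FiniteDimensional ℝ E] [I.Boundaryless] in
lemma fderiv_extChartAt_comp {E₀ : Type*} [NormedAddCommGroup E₀] [NormedSpace ℝ E₀] {j : E₀ → M}
    {u : M} {t : E₀} (ht : j t ∈ (chartAt H u).source) (hj : MDifferentiableAt 𝓘(ℝ, E₀) I j t)
    (v : E₀) : fderiv ℝ (extChartAt I u ∘ j) t v = coord I u (j t) (mfderiv 𝓘(ℝ, E₀) I j t v) := by
  rw [coord_eq_mfderiv ht, ← mfderiv_eq_fderiv,
    mfderiv_comp t (mdifferentiableAt_extChartAt (I := I) ht) hj]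
  rfl

/-- The map `j` plays the role of a parametrized leaf of the radical; in charts this is
`metric_localHessian_leaf_symm`. -/
lemma hessianForm_mfderiv_symm (hn : g.IsLeviCivita nabla) (hf : ContMDiff I I' ∞ f)
    {E₀ : Type*} [NormedAddCommGroup E₀] [NormedSpace ℝ E₀] {j : E₀ → M} {s : E₀}
    (hjs : ContMDiffAt 𝓘(ℝ, E₀) I ∞ j s)
    (hj : ∀ᶠ t in 𝓝 s, MDifferentiableAt 𝓘(ℝ, E₀) I j t ∧
      ∀ v, mfderiv 𝓘(ℝ, E₀) I j t v ∈ radical g f (j t)) (a b : E₀) (y : TangentSpace I (j s)) :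
    hessianForm I g nabla f (j s) (mfderiv 𝓘(ℝ, E₀) I j s b) (mfderiv 𝓘(ℝ, E₀) I j s a) y =
      hessianForm I g nabla f (j s) (mfderiv 𝓘(ℝ, E₀) I j s a) (mfderiv 𝓘(ℝ, E₀) I j s b) y := by
  have hk : ContDiffAt ℝ ∞ (fun t ↦ extChartAt I (j s) (j t)) s := by
    rw [← contMDiffAt_iff_contDiffAt]
    exact (contMDiffAt_extChartAt (n := ∞) (x := j s)).comp s hjs
  have hdk (t : E₀) (hjt : j t ∈ (chartAt H (j s)).source)
      (hj : MDifferentiableAt 𝓘(ℝ, E₀) I j t) (v : E₀) :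
      fderiv ℝ (fun t ↦ extChartAt I (j s) (j t)) t v =
        coord I (j s) (j t) (mfderiv 𝓘(ℝ, E₀) I j t v) := fderiv_extChartAt_comp hjt hj v
  have h := metric_localHessian_leaf_symm (k := fun t ↦ extChartAt I (j s) (j t)) (s₀ := s)
    (isLocalLeviCivita_localMap hn f (j s)) (contDiffAt_localMap hf (j s)) hk (by
      filter_upwards [hj, hjs.continuousAt.eventually (eventually_mem_charts hf (j s))]
        with t ⟨ht, hrad⟩ ⟨hjt, hft⟩ v y
      have h0 := metric_radical (hrad v) (ofCoord I (j s) (j t) y)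
      rw [g.symm, metric_eq_localMetric_along (I := I) g hjt hft, ← fderiv_localMap hf hjt hft,
        ← fderiv_localMap hf hjt hft, coord_ofCoord hjt, ← hdk t hjt ht] at h0
      exact h0) a b (coord I (j s) (j s) y)
  rw [hdk s (mem_chart_source H (j s)) hj.self_of_nhds.1,
    hdk s (mem_chart_source H (j s)) hj.self_of_nhds.1] at h
  rw [hessianForm_apply, hessianForm_apply,
    ← fderiv_localMap hf (mem_chart_source H (j s)) (mem_chart_source H' (f (j s))),
    ← fderiv_localMap hf (mem_chart_source H (j s)) (mem_chart_source H' (f (j s)))]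
  exact h

/-- If the radical is integrable, then the second fundamental forms in the directions of the
radical are symmetric on its leaves. -/
lemma hessianForm_leaf_symm (hn : g.IsLeviCivita nabla) (hf : ContMDiff I I' ∞ f) {k : ℕ}
    (hint : IsIntegrableDistribution k (radical (I := I) g f)) {u : M} {ζ η : TangentSpace I u}
    (hζ : ζ ∈ radical g f u) (hη : η ∈ radical g f u) (y : TangentSpace I u) :
    hessianForm I g nabla f u η ζ y = hessianForm I g nabla f u ζ η y := by
  obtain ⟨U, j, hU, ⟨s, hs, rfl⟩, hj, hrad⟩ := hint u
  have hjt : ∀ t ∈ U, ContMDiffAt (𝓡 k) I ∞ j t := fun t ht ↦ hj.contMDiffAt (hU.mem_nhds ht)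
  rw [← (hrad s hs).2] at hζ hη
  obtain ⟨a, rfl⟩ := hζ
  obtain ⟨b, rfl⟩ := hη
  refine hessianForm_mfderiv_symm hn hf (hjt s hs) ?_ a b y
  filter_upwards [hU.mem_nhds hs] with t ht
  refine ⟨(hjt t ht).mdifferentiableAt (by simp), fun v ↦ ?_⟩
  rw [← (hrad t ht).2]
  exact ⟨v, rfl⟩

/-- The second fundamental forms in the directions of an integrable radical vanish on it. -/
lemma hessianForm_radical (hn : g.IsLeviCivita nabla) (hf : ContMDiff I I' ∞ f) {r : ℕ}
    (hint : IsIntegrableDistribution r (radical (I := I) g f)) {u : M}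
    {ξ : Fin r → Π q : M, TangentSpace I q} {U : Set M} (hU : U ∈ 𝓝 u)
    (hξ : IsDistributionFrameOn (radical g f) ξ U) (i : Fin r) (x : TangentSpace I u)
    {ζ : TangentSpace I u} (hζ : ζ ∈ radical g f u) :
    hessianForm I g nabla f u (ξ i u) x ζ = 0 := by
  have hmem (j : Fin r) : ∀ᶠ q in 𝓝 u, ξ j q ∈ radical g f q := by
    filter_upwards [hU] with q hq
    rw [← hξ.span_eq q hq]
    exact Submodule.subset_span ⟨j, rfl⟩
  rw [← hξ.span_eq u (mem_of_mem_nhds hU)] at hζ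
  induction hζ using Submodule.span_induction with
  | mem ζ h =>
    obtain ⟨j, rfl⟩ := h
    -- Exchanging `ξ i` and `ξ j` changes the sign by metric compatibility (`h1`) and preserves the
    -- value by integrability (`h2`), so the value is zero.
    have h1 := hessianForm_skew hn hf (contDiffAt_localField (hξ.smooth i) hU)
      (contDiffAt_localField (hξ.smooth j) hU) (hmem i) (hmem j) x
    have h2 := hessianForm_leaf_symm hn hf hint (hmem i).self_of_nhds (hmem j).self_of_nhds x
    rw [hessianForm_symm hn hf, hessianForm_symm hn hf (ξ i u)] at h2
    linarith
  | zero => simp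
  | add ζ η _ _ h1 h2 => rw [map_add, h1, h2, add_zero]
  | smul c ζ _ h => rw [map_smul, h, smul_zero]

end HessianForm

/-! ### The Gauss equation and the main result. -/

section GaussEquation

open Filter Topology Bundle

variable {E : Type*} [NormedAddCommGroup E] [NormedSpace ℝ E] [FiniteDimensional ℝ E]
  {H : Type*} [TopologicalSpace H] {I : ModelWithCorners ℝ E H} [I.Boundaryless]
  {M : Type*} [TopologicalSpace M] [ChartedSpace H M] [IsManifold I ∞ M]
  {E' : Type*} [NormedAddCommGroup E'] [NormedSpace ℝ E'] [FiniteDimensional ℝ E']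
  {H' : Type*} [TopologicalSpace H'] {I' : ModelWithCorners ℝ E' H'} [I'.Boundaryless]
  {N : Type*} [TopologicalSpace N] [ChartedSpace H' N] [IsManifold I' ∞ N] [T2Space N]
  {g : SemiRiemannianMetric I' N} {nabla : CovariantDerivative I' E' (TangentSpace I' : N → Type _)}
  {f : M → N} {S : ScreenDistribution I g f} {r : ℕ}
  {ξ : Fin r → Π p : M, TangentSpace I p} {ν : Fin r → Π p : M, TangentSpace I' (f p)} {U : Set M}

namespace IsNullFramePairOn

lemma smoothFieldAt_proj {L : ∀ p : M, Submodule ℝ (TangentSpace I' (f p))}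
    (h : IsNullFramePairOn S L ξ ν U) (hn : g.IsLeviCivita nabla) (hf : ContMDiff I I' ∞ f)
    {u : M} (hU : U ∈ 𝓝 u) {W : Π q : M, TangentSpace I q} (hW : SmoothFieldAt I W u) :
    SmoothFieldAt I (fun q ↦ S.proj q (W q)) u := by
  refine SmoothFieldAt.congr (hW.sub_sum_smul
    (a := fun i q ↦ g.val (f q) (mfderiv I I' f q (W q)) (ν i q)) (W := ξ)
    (fun i ↦ (hW.mfderiv hf).metric hn hf (contDiffAt_localAlong hf (h.smooth i) hU))
    (fun i ↦ contDiffAt_localField (h.frame.smooth i) hU)) ?_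
  filter_upwards [hU] with q hq using h.proj_eq hq (W q)

variable {hf : Manifold.IsImmersion I I' ∞ f} {L : LightlikeTransversalBundle S r}

/-- On a screen conformal submanifold, the shape operators of the transversal frame are
proportional to the second fundamental forms in the directions of the radical. -/
lemma metric_covDerivAlong_transversal (h : IsNullFramePairOn S L.fiber ξ ν U)
    (hn : g.IsLeviCivita nabla) (hint : IsIntegrableDistribution r (radical (I := I) g f))
    {u : M} (hU : U ∈ 𝓝 u) {i : Fin r} {c : ℝ} {X W : Π q : M, TangentSpace I q}
    (hW : SmoothFieldAt I W u)
    (hc : g.val (f u) (mfderiv I I' f u (screenSecondForm nabla hf L X W u)) (ν i u) =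
      c * g.val (f u) (lightlikeSecondForm nabla hf L X (fun q ↦ S.proj q (W q)) u)
        (mfderiv I I' f u (ξ i u))) :
    g.val (f u) (covDerivAlong nabla f (ν i) u (X u)) (mfderiv I I' f u (S.proj u (W u))) =
      -(c * hessianForm I g nabla f u (ξ i u) (X u) (W u)) := by
  have hu := mem_of_mem_nhds hU
  have hPW := h.smoothFieldAt_proj hn hf.contMDiff hU hW
  -- Orthogonality of `ν i` and the screen moves the derivative from `ν i` to `P W`.
  rw [metric_covDerivAlong_of_orthogonal hn hf.contMDiff
    (W := fun q ↦ mfderiv I I' f q (S.proj q (W q)))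
    (contDiffAt_localAlong hf.contMDiff (h.smooth i) hU) (hPW.mfderiv hf.contMDiff) (by
      filter_upwards [hU] with q hq
      rw [g.symm, h.orthogonal_screen q hq i _ (S.proj_mem q _)]), g.symm]
  -- The field `W` may be replaced by `P W` because the form vanishes on the radical; this is where
  -- integrability enters.
  have e : hessianForm I g nabla f u (ξ i u) (X u) (W u) =
      g.val (f u) (covDerivAlong nabla f (fun q ↦ mfderiv I I' f q (S.proj q (W q))) u (X u))
        (mfderiv I I' f u (ξ i u)) := by
    rw [metric_covDerivAlong_mfderiv hf.contMDiff hPW (h.mem_radical hu i), ← sub_eq_zero,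
      ← map_sub]
    exact hessianForm_radical hn hf.contMDiff hint hU h.frame i _ (S.sub_proj_mem u _)
  -- Paired with `ν i`, the screen part of the induced derivative vanishes, and so do its
  -- transversal corrections because the `ν j` are mutually null; what is left is the full ambient
  -- derivative.
  rw [screenSecondForm, lightlikeSecondForm, map_sub, map_sub, sub_apply, map_sub, sub_apply,
    h.orthogonal_screen u hu i _ (S.proj_mem u _), metric_radical (h.mem_radical hu i), sub_zero,
    sub_zero, inducedConnection, mfderiv_tangentialPart h hu, map_sub, map_sum, sub_apply,
    sum_apply, Finset.sum_eq_zero, sub_zero, ← e] at hc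
  · rw [hc]
  · intro j _
    rw [map_smul, smul_apply, h.null u hu, smul_zero]

/-- By the Gauss formula the induced derivative is the ambient one minus a combination of the `ν i`.
Differentiating it again, the derivatives of the coefficients multiply `ν i`, which is orthogonal to
the screen, so only the derivatives of the `ν i` survive. -/
lemma metric_covDerivAlong_inducedConnection (h : IsNullFramePairOn S L.fiber ξ ν U)
    (hn : g.IsLeviCivita nabla) {u : M} (hU : U ∈ 𝓝 u) {Y Z : Π q : M, TangentSpace I q}
    (hY : SmoothFieldAt I Y u) (hZ : SmoothFieldAt I Z u) (x w : TangentSpace I u) :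
    g.val (f u) (covDerivAlong nabla f
        (fun q ↦ mfderiv I I' f q (inducedConnection nabla hf L Y Z q)) u x)
        (mfderiv I I' f u (S.proj u w)) =
      g.val (f u) (covDerivAlong nabla f
        (fun q ↦ covDerivAlong nabla f (fun q ↦ mfderiv I I' f q (Z q)) q (Y q)) u x)
        (mfderiv I I' f u (S.proj u w)) -
      ∑ i, hessianForm I g nabla f u (ξ i u) (Y u) (Z u) *
        g.val (f u) (covDerivAlong nabla f (ν i) u x) (mfderiv I I' f u (S.proj u w)) := by
  have hu := mem_of_mem_nhds hU
  have hD := (hZ.mfderiv hf.contMDiff).covDerivAlong hn hf.contMDiff hY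
  have ha := fun i ↦ hD.metric hn hf.contMDiff
    (SmoothFieldAt.mfderiv hf.contMDiff (contDiffAt_localField (h.frame.smooth i) hU))
  have hν := fun i ↦ contDiffAt_localAlong hf.contMDiff (h.smooth i) hU
  obtain ⟨c, e⟩ := covDerivAlong_sub_sum_smul (nabla := nabla) hf.contMDiff hD ha hν x
  rw [covDerivAlong_congr hf.contMDiff (hD.sub_sum_smul ha hν) (by
    filter_upwards [hU] with q hq using mfderiv_tangentialPart h hq _), e, map_sub, map_sum,
    sub_apply, sum_apply]
  congr 1
  refine Finset.sum_congr rfl fun i _ ↦ ?_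
  rw [map_add, map_smul, map_smul, add_apply, smul_apply, smul_apply, g.symm (f u) (ν i u),
    h.orthogonal_screen u hu i _ (S.proj_mem u w), smul_zero, zero_add, smul_eq_mul,
    metric_covDerivAlong_mfderiv hf.contMDiff hZ (h.mem_radical hu i)]

/-- The Gauss equation of a screen conformal coisotropic submanifold. -/
lemma inducedMetric_curvature (h : IsNullFramePairOn S L.fiber ξ ν U)
    (hn : g.IsLeviCivita nabla) (hint : IsIntegrableDistribution r (radical (I := I) g f))
    {φ : Fin r → M → ℝ}
    (hconf : ∀ X Y : Π q : M, TangentSpace I q, SmoothFieldOn X U → SmoothFieldOn Y U →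
      ∀ q ∈ U, ∀ i, g.val (f q) (mfderiv I I' f q (screenSecondForm nabla hf L X Y q)) (ν i q) =
        φ i q * g.val (f q) (lightlikeSecondForm nabla hf L X (fun q' ↦ S.proj q' (Y q')) q)
          (mfderiv I I' f q (ξ i q)))
    {u : M} (hU : U ∈ 𝓝 u) {X Y Z W : Π q : M, TangentSpace I q} (hX : SmoothFieldOn X U)
    (hY : SmoothFieldOn Y U) (hZ : SmoothFieldOn Z U) (hW : SmoothFieldOn W U) :
    inducedMetric g f u (curvature (inducedConnection nabla hf L) X Y Z u) (W u) =
      g.val (f u) (curvatureAt nabla (f u) (mfderiv I I' f u (X u)) (mfderiv I I' f u (Y u))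
        (mfderiv I I' f u (Z u))) (mfderiv I I' f u (S.proj u (W u))) +
      ∑ i, φ i u * (hessianForm I g nabla f u (ξ i u) (Y u) (Z u) *
          hessianForm I g nabla f u (ξ i u) (X u) (W u) -
        hessianForm I g nabla f u (ξ i u) (X u) (Z u) *
          hessianForm I g nabla f u (ξ i u) (Y u) (W u)) := by
  have hu := mem_of_mem_nhds hU
  have hX' : SmoothFieldAt I X u := contDiffAt_localField hX hU
  have hY' : SmoothFieldAt I Y u := contDiffAt_localField hY hU
  have hZ' : SmoothFieldAt I Z u := contDiffAt_localField hZ hU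
  have hW' : SmoothFieldAt I W u := contDiffAt_localField hW hU
  have e : inducedMetric g f u (curvature (inducedConnection nabla hf L) X Y Z u) (W u) =
      inducedMetric g f u (tangentialPart hf L u (covDerivAlong nabla f
        (fun q ↦ mfderiv I I' f q (inducedConnection nabla hf L Y Z q)) u (X u))) (W u) -
      inducedMetric g f u (tangentialPart hf L u (covDerivAlong nabla f
        (fun q ↦ mfderiv I I' f q (inducedConnection nabla hf L X Z q)) u (Y u))) (W u) -
      inducedMetric g f u (tangentialPart hf L u (covDerivAlong nabla f
        (fun q ↦ mfderiv I I' f q (Z q)) u (VectorField.mlieBracket I X Y u))) (W u) := by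
    rw [← LinearMap.sub_apply, ← LinearMap.sub_apply, ← map_sub, ← map_sub]
    rfl
  rw [e, inducedMetric_tangentialPart h hu, inducedMetric_tangentialPart h hu,
    inducedMetric_tangentialPart h hu, h.metric_covDerivAlong_inducedConnection hn hU hY' hZ',
    h.metric_covDerivAlong_inducedConnection hn hU hX' hZ',
    ← covDerivAlong_commutator hn hf.contMDiff (hZ'.mfderiv hf.contMDiff) hX' hY', map_sub,
    map_sub, sub_apply, sub_apply]
  -- Screen conformality turns both shape-operator terms into multiples of the same form by the same
  -- factor `φ i u`, which produces the Kulkarni-Nomizu product.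
  have hs : ∀ i, φ i u * (hessianForm I g nabla f u (ξ i u) (Y u) (Z u) *
          hessianForm I g nabla f u (ξ i u) (X u) (W u) -
        hessianForm I g nabla f u (ξ i u) (X u) (Z u) *
          hessianForm I g nabla f u (ξ i u) (Y u) (W u)) =
      hessianForm I g nabla f u (ξ i u) (X u) (Z u) * g.val (f u)
        (covDerivAlong nabla f (ν i) u (Y u)) (mfderiv I I' f u (S.proj u (W u))) -
      hessianForm I g nabla f u (ξ i u) (Y u) (Z u) * g.val (f u)
        (covDerivAlong nabla f (ν i) u (X u)) (mfderiv I I' f u (S.proj u (W u))) := fun i ↦ by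
    rw [h.metric_covDerivAlong_transversal hn hint hU hW' (hconf X W hX hW u hu i),
      h.metric_covDerivAlong_transversal hn hint hU hW' (hconf Y W hY hW u hu i)]
    ring
  simp only [hs, Finset.sum_sub_distrib]
  ring

end IsNullFramePairOn

/-- The curvature of a screen conformal coisotropic submanifold with integrable radical is an
algebraic curvature tensor, if the ambient curvature preserves the radical. -/
theorem exists_isAlgebraicCurvatureTensor_inducedConnection (hn : g.IsLeviCivita nabla)
    (hf : Manifold.IsImmersion I I' ∞ f) (L : LightlikeTransversalBundle S r)
    (hconf : IsScreenConformal nabla hf L)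
    (hint : IsIntegrableDistribution r (radical (I := I) g f))
    (hhol : ∀ (p : M) (x y : TangentSpace I p), ∀ ξ ∈ radical g f p, ∃ ζ ∈ radical g f p,
      curvatureAt nabla (f p) (mfderiv I I' f p x) (mfderiv I I' f p (S.proj p y))
        (mfderiv I I' f p ξ) = mfderiv I I' f p ζ) (u : M) :
    ∃ F : TangentSpace I u →ₗ[ℝ] TangentSpace I u →ₗ[ℝ] TangentSpace I u →ₗ[ℝ]
        TangentSpace I u →ₗ[ℝ] ℝ, IsAlgebraicCurvatureTensor F ∧
      ∀ X Y Z W : Π p : M, TangentSpace I p, SmoothFieldOn X Set.univ → SmoothFieldOn Y Set.univ →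
        SmoothFieldOn Z Set.univ → SmoothFieldOn W Set.univ →
        inducedMetric g f u (curvature (inducedConnection nabla hf L) X Y Z u) (W u) =
          F (X u) (Y u) (Z u) (W u) := by
  obtain ⟨U, hU, hu, ξ, ν, φ, h, -, hc⟩ := hconf u
  have hLC := isLocalLeviCivita hn (f u)
  have hz := mem_chart_source H' (f u)
  have hcoord (a b c d : TangentSpace I' (f u)) : g.val (f u) (curvatureAt nabla (f u) a b c) d =
      localMetric g (f u) (extChartAt I' (f u) (f u)) (localCurvature (christoffel nabla (f u))
        (extChartAt I' (f u) (f u)) (coord I' (f u) (f u) a) (coord I' (f u) (f u) b)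
        (coord I' (f u) (f u) c)) (coord I' (f u) (f u) d) := by
    rw [metric_eq_localMetric g hz, coord_curvatureAt hn.smooth]
  -- Here `K` is the ambient curvature pulled back to the tangent space of `M`; its symmetries are
  -- checked in the chart at `f u`.
  obtain ⟨F, hF, e⟩ := exists_isAlgebraicCurvatureTensor (V := TangentSpace I u)
    (K := fun x y z w ↦ g.val (f u) (curvatureAt nabla (f u) (mfderiv I I' f u x)
      (mfderiv I I' f u y) (mfderiv I I' f u z)) (mfderiv I I' f u w))
    (fun x y z ↦ ⟨fun w w' ↦ by simp only [map_add], fun c w ↦ by simp only [map_smul]⟩)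
    (fun x y z w ↦ by
      simp only [hcoord]
      rw [localCurvature_antisymm, map_neg, neg_apply])
    (fun x y z w ↦ by
      simp only [hcoord]
      rw [localCurvature_skew hLC])
    (fun x y z w ↦ by
      simp only [hcoord]
      rw [← add_apply, ← add_apply, ← map_add, ← map_add, localCurvature_bianchi hLC, map_zero,
        zero_apply])
    (S.proj u) (radical g f u) (S.sub_proj_mem u)
    (fun x y ζ hζ z ↦ by
      obtain ⟨η, hη, e⟩ := hhol u x y ζ hζ
      rw [e, mem_radical_iff.1 hη])
    (fun i ↦ φ i u) (fun i ↦ hessianForm I g nabla f u (ξ i u))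
    (fun i ↦ hessianForm_symm hn hf.contMDiff (ξ i u))
  refine ⟨F, hF, fun X Y Z W hX hY hZ hW ↦ ?_⟩
  rw [e, h.inducedMetric_curvature hn hint hc (hU.mem_nhds hu) (hX.mono (Set.subset_univ U))
    (hY.mono (Set.subset_univ U)) (hZ.mono (Set.subset_univ U)) (hW.mono (Set.subset_univ U))]

end GaussEquation

end CoisotropicGeometry

theorem theorem3p5 {m n : ℕ}
    -- the ambient semi-Riemannian manifold `N` of dimension `m + n`
    {N : Type*} [TopologicalSpace N] [T2Space N] [SecondCountableTopology N]
    [ChartedSpace (EuclideanSpace ℝ (Fin (m + n))) N] [IsManifold (𝓡 (m + n)) ∞ N]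
    (g : SemiRiemannianMetric (𝓡 (m + n)) N)
    (nabla : CovariantDerivative (𝓡 (m + n)) (EuclideanSpace ℝ (Fin (m + n)))
      (TangentSpace (𝓡 (m + n)) : N → Type _))
    (hnabla : g.IsLeviCivita nabla)
    -- the submanifold `f : M → N` of codimension `n`, its screen distribution `S`, and a lightlike
    -- transversal bundle `L`
    {M : Type*} [TopologicalSpace M] [T2Space M] [SecondCountableTopology M]
    [ChartedSpace (EuclideanSpace ℝ (Fin m)) M] [IsManifold (𝓡 m) ∞ M]
    (f : M → N) (hf : Manifold.IsImmersion (𝓡 m) (𝓡 (m + n)) ∞ f)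
    (hcoiso : IsCoisotropic (𝓡 m) g f n)
    (S : ScreenDistribution (𝓡 m) g f) (L : LightlikeTransversalBundle S n)
    (hconf : IsScreenConformal nabla hf L)
    (hint : IsIntegrableDistribution n (radical (I := 𝓡 m) g f))
    -- the holonomy condition: `R̄(X, PY)` maps `Rad TM` into `Rad TM`
    (hhol : ∀ (p : M) (x y : TangentSpace (𝓡 m) p), ∀ ξ ∈ radical g f p,
      ∃ ζ ∈ radical g f p,
        curvatureAt nabla (f p) (mfderiv (𝓡 m) (𝓡 (m + n)) f p x)
          (mfderiv (𝓡 m) (𝓡 (m + n)) f p (S.proj p y)) (mfderiv (𝓡 m) (𝓡 (m + n)) f p ξ) =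
          mfderiv (𝓡 m) (𝓡 (m + n)) f p ζ) :
    -- at every point, `g(R(X, Y) Z, W)` is given by an algebraic curvature tensor
    ∀ u : M, ∃ F : TangentSpace (𝓡 m) u →ₗ[ℝ] TangentSpace (𝓡 m) u →ₗ[ℝ]
        TangentSpace (𝓡 m) u →ₗ[ℝ] TangentSpace (𝓡 m) u →ₗ[ℝ] ℝ,
      IsAlgebraicCurvatureTensor F ∧
        ∀ X Y Z W : Π p : M, TangentSpace (𝓡 m) p,
          SmoothFieldOn X Set.univ → SmoothFieldOn Y Set.univ →
          SmoothFieldOn Z Set.univ → SmoothFieldOn W Set.univ →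
          inducedMetric g f u (curvature (inducedConnection nabla hf L) X Y Z u) (W u) =
            F (X u) (Y u) (Z u) (W u) :=
  exists_isAlgebraicCurvatureTensor_inducedConnection hnabla hf L hconf hint hhol
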